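/- Identify $\mathbb{R}^4\times\mathbb{R}^4$ with $\mathbb{C}^4$ by $z=x+ip$, let $\omega=\sum_j dx_j\wedge dp_j$, and let $T^*S^3=\{(x,p):|x|=1,\ p\cdot x=0\}$. Let $F(x,p)=(|p|x,p)$ be the contraction of $T^*S^3$ onto the conifold $\mathcal{C}=\{z\in\mathbb{C}^4:\sum_j z_j^2=0\}$. Let $$\widehat{\mathcal{C}}=\{([u:v],z)\in\mathbb{CP}^1\times\mathbb{C}^4:\ w_1v-w_2u=w_3v-w_4u=0\},$$ where $w_1=z_1+iz_2$, $w_2=-z_3+iz_4$, $w_3=z_3+iz_4$, $w_4=z_1-iz_2$, be the resolved conifold, with projections $\pi_1,\pi_2$ to $\mathbb{CP}^1$ and $\mathbb{C}^4$, its complex structure $J$, the metric $\widehat g=\pi_1^*g_{FS}+\pi_2^*g_{st}$, and zero section $0(\widehat{\mathcal{C}})=\pi_2^{-1}(0)$. For $N\subset T^*S^3$ the conifold transition is $\mathrm{CT}(N)=\overline{\pi_2^{-1}(F(N)\setminus\{0\})}$. Let $k$ be a smooth knot in $S^3\subset\mathbb{R}^4$ parametrized by arc length, let $0<\varepsilon<1$,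 and let $$N^*_{k,\varepsilon}=\{(k(t),\,p+\varepsilon\dot k(t)):\ p\cdot k(t)=p\cdot\dot k(t)=0\}$$ be its perturbed conormal bundle. Then there is a smooth vector field $\xi$ on $\mathbb{R}^4$ with bounded derivative and with $\xi(r\,k(t))=\dot k(t)$ for all $t$ and all $r\ge\varepsilon$ (in particular $\xi(k(t))=\dot k(t)$) such that, with $\Phi_\varepsilon(x,p)=(x,p+\varepsilon\xi(x))$ and $\widetilde\omega_\varepsilon=(\pi_2^{-1})_*\Phi_{\varepsilon*}\omega$ (that is, the pullback by $\pi_2$ of $(\Phi_\varepsilon^{-1})^*\omega$), the following hold. (1) $\mathrm{CT}(N^*_{k,\varepsilon})$ is a uniformly tame Lagrangian in $\widehat{\mathcal{C}}$ by virtue of $\widetilde\omega_\varepsilon$: it is a smooth embedded submanifold of half the dimension of $\widehat{\mathcal{C}}$; on some open neighbourhood of it the form $\widetilde\omega_\varepsilon$ is symplectic and uniformly tame, i.e. there is a constant $C\ge1$ with $C^{-1}\widehat g(X,X)\le\widetilde\omega_\varepsilon(X,JX)\le C\,\widehat g(X,X)$ for all tangent vectors $X$ there; and $\widetilde\omega_\varepsilon$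 vanishes on the tangent spaces of $\mathrm{CT}(N^*_{k,\varepsilon})$. (2) $\widetilde\omega_\varepsilon$ is exact on $\widehat{\mathcal{C}}\setminus0(\widehat{\mathcal{C}})$. -/

import Mathlib

open Complex Set
open scoped Manifold ContDiff Topology

noncomputable section

namespace Conifold

/-! ## Differential forms, submanifolds and tame Lagrangians on a smooth manifold -/

section Manifold

variable {E : Type*} [NormedAddCommGroup E] [NormedSpace ℝ E]
variable {M : Type*} [TopologicalSpace M] [ChartedSpace E M]

variable (E M) in
/-- A (not necessarily continuous) field of alternating `n`-linear forms on the tangent spaces. -/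
abbrev Form (n : ℕ) : Type _ := ∀ q : M, TangentSpace 𝓘(ℝ, E) q [⋀^Fin n]→L[ℝ] ℝ

/-- The expression of a form in a chart: its pullback by the inverse of the chart. -/
def Form.inChart {n : ℕ} (α : Form E M n) (e : OpenPartialHomeomorph M E) :
    E → E [⋀^Fin n]→L[ℝ] ℝ := fun y =>
  (α (e.symm y)).compContinuousLinearMap (mfderiv 𝓘(ℝ, E) 𝓘(ℝ, E) e.symm y)

/-- `α` is a smooth differential form on the open set `U`. -/
def Form.SmoothOn {n : ℕ} (α : Form E M n) (U : Set M) : Prop :=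
  ∀ e ∈ atlas E M, ContDiffOn ℝ ∞ (α.inChart e) (e.target ∩ e.symm ⁻¹' U)

/-- The exterior derivative of a differential form, computed in the preferred chart at each
point. -/
def Form.d {n : ℕ} (α : Form E M n) : Form E M (n + 1) := fun q =>
  (extDeriv (α.inChart (chartAt E q)) (chartAt E q q)).compContinuousLinearMap
    (mfderiv 𝓘(ℝ, E) 𝓘(ℝ, E) (chartAt E q) q)

/-- `α` is exact on the open set `U`: it has a smooth primitive there. -/
def Form.ExactOn {n : ℕ} (α : Form E M (n + 1)) (U : Set M) : Prop :=
  ∃ μ : Form E M n, μ.SmoothOn U ∧ ∀ q ∈ U, α q = μ.d q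

/-- `α` is a symplectic form on the open set `U`: smooth, closed and nondegenerate. -/
def Form.SymplecticOn (α : Form E M 2) (U : Set M) : Prop :=
  α.SmoothOn U ∧ (∀ q ∈ U, α.d q = 0) ∧
    ∀ q ∈ U, ∀ X : TangentSpace 𝓘(ℝ, E) q, X ≠ 0 → ∃ Y, α q ![X, Y] ≠ 0

/-- `α` is uniformly tame on `U`, with respect to the almost complex structure `J` and the
Riemannian metric `g`. -/
def Form.UniformlyTameOn (α : Form E M 2)
    (J : ∀ q : M, TangentSpace 𝓘(ℝ, E) q →L[ℝ] TangentSpace 𝓘(ℝ, E) q)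
    (g : ∀ q : M, TangentSpace 𝓘(ℝ, E) q → TangentSpace 𝓘(ℝ, E) q → ℝ) (U : Set M) : Prop :=
  ∃ C : ℝ, 1 ≤ C ∧ ∀ q ∈ U, ∀ X : TangentSpace 𝓘(ℝ, E) q,
    C⁻¹ * g q X X ≤ α q ![X, J q X] ∧ α q ![X, J q X] ≤ C * g q X X

variable (E) in
/-- `L` is a smooth embedded submanifold of dimension `d`: near each of its points it is a
`d`-dimensional linear slice in some chart of the smooth structure. -/
def IsEmbeddedSubmanifold (d : ℕ) (L : Set M) : Prop :=
  ∀ q ∈ L, ∃ e ∈ IsManifold.maximalAtlas 𝓘(ℝ, E) ∞ M, q ∈ e.source ∧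
    ∃ V : Submodule ℝ E, Module.finrank ℝ V = d ∧ e.source ∩ L = e.source ∩ e ⁻¹' V

variable (E) in
/-- The tangent vectors to `L` at `q`: the velocities at time `0` of the smooth curves in `L`
through `q`. -/
def tangentVectors (L : Set M) (q : M) : Set (TangentSpace 𝓘(ℝ, E) q) :=
  {X | ∃ (γ : ℝ → M) (h : γ 0 = q), ContMDiffAt 𝓘(ℝ, ℝ) 𝓘(ℝ, E) ∞ γ 0 ∧ (∀ᶠ t in 𝓝 0, γ t ∈ L) ∧
    X = h ▸ mfderiv 𝓘(ℝ, ℝ) 𝓘(ℝ, E) γ 0 (1 : ℝ)}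

/-- `L` is a (uniformly) tame Lagrangian in `(M, J, g)` by virtue of the form `α`: it is an embedded
submanifold of half the dimension of `M`, the form `α` is symplectic and uniformly tame on a
neighbourhood of `L`, and `α` vanishes on the tangent spaces of `L`. -/
def IsTameLagrangian
    (J : ∀ q : M, TangentSpace 𝓘(ℝ, E) q →L[ℝ] TangentSpace 𝓘(ℝ, E) q)
    (g : ∀ q : M, TangentSpace 𝓘(ℝ, E) q → TangentSpace 𝓘(ℝ, E) q → ℝ)
    (α : Form E M 2) (L : Set M) : Prop :=
  (∃ d : ℕ, 2 * d = Module.finrank ℝ E ∧ IsEmbeddedSubmanifold E d L) ∧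
  (∃ U : Set M, IsOpen U ∧ L ⊆ U ∧ α.SymplecticOn U ∧ α.UniformlyTameOn J g U) ∧
  ∀ q ∈ L, ∀ X ∈ tangentVectors E L q, ∀ Y ∈ tangentVectors E L q, α q ![X, Y] = 0

end Manifold

/-! ## `ℝ⁴ × ℝ⁴ = ℂ⁴` -/

abbrev R4 : Type := EuclideanSpace ℝ (Fin 4)

abbrev C4 : Type := EuclideanSpace ℂ (Fin 4)

/-- The Euclidean inner product of a complex inner product space, as a real one. -/
def realInner {V : Type*} [NormedAddCommGroup V] [InnerProductSpace ℂ V] (a b : V) : ℝ :=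
  (inner ℂ a b).re

/-- The real part `x` of `z = x + i p`. -/
def rePart (z : C4) : R4 := WithLp.toLp 2 fun j => (z j).re

/-- The imaginary part `p` of `z = x + i p`. -/
def imPart (z : C4) : R4 := WithLp.toLp 2 fun j => (z j).im

/-- The identification `(x, p) ↦ x + i p`. -/
def ofXP (x p : R4) : C4 := WithLp.toLp 2 fun j => (x j : ℂ) + p j * I

/-- The real-linear coordinate `x_j` on `ℂ⁴`. -/
def dx (j : Fin 4) : C4 →L[ℝ] ℝ :=
  Complex.reCLM ∘L (EuclideanSpace.proj j : C4 →L[ℂ] ℂ).restrictScalars ℝ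

/-- The real-linear coordinate `p_j` on `ℂ⁴`. -/
def dp (j : Fin 4) : C4 →L[ℝ] ℝ :=
  Complex.imCLM ∘L (EuclideanSpace.proj j : C4 →L[ℂ] ℂ).restrictScalars ℝ

/-- The wedge product of two linear functionals. -/
def wedge {V : Type*} [NormedAddCommGroup V] [NormedSpace ℝ V] (a b : V →L[ℝ] ℝ) :
    V [⋀^Fin 2]→L[ℝ] ℝ :=
  ContinuousMultilinearMap.alternatization
    ((ContinuousMultilinearMap.mkPiAlgebra ℝ (Fin 2) ℝ).compContinuousLinearMap ![a, b])

theorem wedge_apply {V : Type*} [NormedAddCommGroup V] [NormedSpace ℝ V] (a b : V →L[ℝ] ℝ)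
    (X Y : V) : wedge a b ![X, Y] = a X * b Y - a Y * b X := by
  have h : (Finset.univ : Finset (Equiv.Perm (Fin 2))) = {1, Equiv.swap 0 1} := by decide
  have h' : (1 : Equiv.Perm (Fin 2)) ≠ Equiv.swap 0 1 := by decide
  simp [wedge, ContinuousMultilinearMap.alternatization_apply_apply, Fin.prod_univ_two, h,
    Finset.sum_pair h', sub_eq_add_neg]

/-- The standard Kähler form `∑ dx_j ∧ dp_j` on `ℂ⁴`. -/
def stdForm : C4 [⋀^Fin 2]→L[ℝ] ℝ := ∑ j, wedge (dx j) (dp j)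

/-- The pushforward `Φ_* β = (Φ⁻¹)^* β` of a 2-form on `ℂ⁴` by a diffeomorphism `Φ`. -/
def pushforward (Φ : C4 ≃ C4) (β : C4 → C4 [⋀^Fin 2]→L[ℝ] ℝ) : C4 → C4 [⋀^Fin 2]→L[ℝ] ℝ :=
  fun z => (β (Φ.symm z)).compContinuousLinearMap (fderiv ℝ Φ.symm z)

/-- The fibrewise translation `Φ_ε(x, p) = (x, p + ε ξ(x))` of `ℝ⁴ × ℝ⁴`. -/
def shear (ξ : R4 → R4) (ε : ℝ) : C4 ≃ C4 where
  toFun z := ofXP (rePart z) (imPart z + ε • ξ (rePart z))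
  invFun z := ofXP (rePart z) (imPart z - ε • ξ (rePart z))
  left_inv z := by ext j; apply Complex.ext <;> simp [ofXP, rePart, imPart]
  right_inv z := by ext j; apply Complex.ext <;> simp [ofXP, rePart, imPart]

/-! ## Knots and conormal bundles -/

/-- A smooth knot in the unit sphere `S³ ⊆ ℝ⁴`, with a parametrization by arc length. -/
structure Knot where
  toFun : ℝ → R4
  length : ℝ
  length_pos : 0 < length
  smooth : ContDiff ℝ ∞ toFun
  periodic : Function.Periodic toFun length
  injOn : InjOn toFun (Ico 0 length)
  norm_eq_one : ∀ t, ‖toFun t‖ = 1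
  unit_speed : ∀ t, ‖deriv toFun t‖ = 1

/-- The perturbed conormal bundle in `T^*S³ = {(x, p) | |x| = 1, p ⬝ x = 0}`. -/
def perturbedConormal (k : Knot) (ε : ℝ) : Set (R4 × R4) :=
  {y | ∃ (t : ℝ) (p : R4), inner ℝ p (k.toFun t) = 0 ∧ inner ℝ p (deriv k.toFun t) = 0 ∧
    y = (k.toFun t, p + ε • deriv k.toFun t)}

/-- The contraction `F(x, p) = (|p| x, p)` of `T^*S³` onto the conifold `{z | ∑ z_j² = 0}`. -/
def contraction (y : R4 × R4) : C4 := ofXP (‖y.2‖ • y.1) y.2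

/-! ## The complex projective line -/

/-- The complex projective line. -/
def CP1 : Type := Projectivization ℂ (Fin 2 → ℂ)

instance : TopologicalSpace CP1 :=
  inferInstanceAs (TopologicalSpace (Quotient (projectivizationSetoid ℂ (Fin 2 → ℂ))))

/-- Homogeneous coordinates. -/
def CP1.hom (p : CP1) : Fin 2 → ℂ := Projectivization.rep p

theorem CP1.hom_ne_zero (p : CP1) : p.hom ≠ 0 := Projectivization.rep_nonzero p

/-- The point `[v]` of the projective line. -/
def CP1.mk (v : Fin 2 → ℂ) (hv : v ≠ 0) : CP1 := Projectivization.mk ℂ v hv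

theorem CP1.exists_hom_mk (v : Fin 2 → ℂ) (hv : v ≠ 0) :
    ∃ a : ℂ, a ≠ 0 ∧ (CP1.mk v hv).hom = a • v := by
  obtain ⟨a, ha⟩ := Projectivization.exists_smul_eq_mk_rep ℂ v hv
  exact ⟨a, a.ne_zero, ha.symm⟩

theorem CP1.mk_eq_of_smul {v : Fin 2 → ℂ} (hv : v ≠ 0) (p : CP1) (a : ℂ) (h : a • p.hom = v) :
    CP1.mk v hv = p := by
  refine ((Projectivization.mk_eq_mk_iff' ℂ _ _ hv p.hom_ne_zero).2 ⟨a, h⟩).trans ?_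
  exact Projectivization.mk_rep _

theorem CP1.continuous_mk : Continuous fun v : {v : Fin 2 → ℂ // v ≠ 0} => CP1.mk v v.2 :=
  continuous_quotient_mk'

theorem CP1.isQuotientMap_mk :
    Topology.IsQuotientMap fun v : {v : Fin 2 → ℂ // v ≠ 0} => CP1.mk v v.2 :=
  isQuotientMap_quotient_mk'

/-- The vector with `i`-th entry `1` and the other entry `c`. -/
def affineVec (i : Fin 2) (c : ℂ) : Fin 2 → ℂ := fun j => if j = i then 1 else c

theorem affineVec_ne_zero (i : Fin 2) (c : ℂ) : affineVec i c ≠ 0 := fun h => by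
  simpa [affineVec] using congrFun h i

theorem hom_eq_smul_affineVec (i : Fin 2) (v : Fin 2 → ℂ) (h : v i ≠ 0) :
    (v i)⁻¹ • v = affineVec i (v (i + 1) / v i) := by
  ext j
  fin_cases i <;> fin_cases j <;> simp_all [affineVec] <;> field_simp

theorem CP1.isOpen_ne (i : Fin 2) : IsOpen {p : CP1 | p.hom i ≠ 0} := by
  rw [← CP1.isQuotientMap_mk.isOpen_preimage]
  have : (fun v : {v : Fin 2 → ℂ // v ≠ 0} => CP1.mk v v.2) ⁻¹' {p : CP1 | p.hom i ≠ 0} =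
      {v | v.1 i ≠ 0} := by
    ext v
    obtain ⟨a, ha, h⟩ := CP1.exists_hom_mk v.1 v.2
    simp [h, ha]
  erw [this]
  exact isOpen_ne_fun ((continuous_apply i).comp continuous_subtype_val) continuous_const

theorem CP1.continuousOn_affine (i : Fin 2) :
    ContinuousOn (fun p : CP1 => p.hom (i + 1) / p.hom i) {p : CP1 | p.hom i ≠ 0} := by
  rw [continuousOn_iff_continuous_domRestrict,
    (CP1.isQuotientMap_mk.restrictPreimage_isOpen (CP1.isOpen_ne i)).continuous_iff]
  have key : ∀ v : {v : Fin 2 → ℂ // v ≠ 0},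
      (CP1.mk v.1 v.2).hom (i + 1) / (CP1.mk v.1 v.2).hom i = v.1 (i + 1) / v.1 i := by
    intro v
    obtain ⟨a, ha, h⟩ := CP1.exists_hom_mk v.1 v.2
    simp only [h, Pi.smul_apply, smul_eq_mul]
    rw [mul_div_mul_left _ _ ha]
  have hne : ∀ x : (fun v : {v : Fin 2 → ℂ // v ≠ 0} => CP1.mk v v.2) ⁻¹'
      {p : CP1 | p.hom i ≠ 0}, x.1.1 i ≠ 0 := by
    rintro ⟨v, hv⟩
    obtain ⟨a, ha, h⟩ := CP1.exists_hom_mk v.1 v.2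
    simp only [mem_preimage, mem_ofPred_eq, h, Pi.smul_apply, smul_eq_mul] at hv
    exact right_ne_zero_of_mul hv
  have hc : ∀ j : Fin 2, Continuous fun x : (fun v : {v : Fin 2 → ℂ // v ≠ 0} => CP1.mk v v.2) ⁻¹'
      {p : CP1 | p.hom i ≠ 0} => x.1.1 j := fun j =>
    (continuous_apply j).comp (continuous_subtype_val.comp continuous_subtype_val)
  refine Continuous.congr (f := fun x => x.1.1 (i + 1) / x.1.1 i) ?_ fun x => (key x.1).symm
  exact Continuous.div (hc (i + 1)) (hc i) hne

/-- The affine chart of the projective line where the `i`-th homogeneous coordinate does not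
vanish; so `CP1.chart 1` is `[u : v] ↦ u / v`. -/
def CP1.chart (i : Fin 2) : OpenPartialHomeomorph CP1 ℂ where
  toFun p := p.hom (i + 1) / p.hom i
  invFun c := CP1.mk (affineVec i c) (affineVec_ne_zero i c)
  source := {p | p.hom i ≠ 0}
  target := univ
  map_source' _ _ := mem_univ _
  map_target' c _ := by
    obtain ⟨a, ha, h⟩ := CP1.exists_hom_mk _ (affineVec_ne_zero i c)
    simp [h, ha, affineVec]
  left_inv' p hp := CP1.mk_eq_of_smul _ p _ (hom_eq_smul_affineVec i p.hom hp)
  right_inv' c _ := by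
    obtain ⟨a, ha, h⟩ := CP1.exists_hom_mk _ (affineVec_ne_zero i c)
    simp [h, ha, affineVec]
  open_source := CP1.isOpen_ne i
  open_target := isOpen_univ
  continuousOn_toFun := CP1.continuousOn_affine i
  continuousOn_invFun := by
    refine Continuous.continuousOn ?_
    refine CP1.continuous_mk.comp (f := fun c => ⟨affineVec i c, affineVec_ne_zero i c⟩) ?_
    refine Continuous.subtype_mk (continuous_pi fun j => ?_) _
    by_cases h : j = i <;> simp [affineVec, h] <;> fun_prop

/-- The index of the preferred chart at a point. -/
def CP1.index (p : CP1) : Fin 2 := if p.hom 1 ≠ 0 then 1 else 0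

theorem CP1.hom_index_ne_zero (p : CP1) : p.hom p.index ≠ 0 := by
  unfold CP1.index
  split_ifs with h
  · exact h
  · intro h0
    apply p.hom_ne_zero
    ext j
    fin_cases j
    · exact h0
    · simpa using h

instance : ChartedSpace ℂ CP1 where
  atlas := range CP1.chart
  chartAt p := CP1.chart p.index
  mem_chart_source := CP1.hom_index_ne_zero
  chart_mem_atlas _ := mem_range_self _

/-- The Fubini-Study metric `|dc|² / (1 + |c|²)²`, in the affine coordinate `c` given by the
preferred chart at `p` (the expression is the same in both charts). -/
def fubiniStudy (p : CP1) (a b : TangentSpace 𝓘(ℝ, ℂ) p) : ℝ :=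
  realInner (V := ℂ) a b / (1 + ‖chartAt ℂ p p‖ ^ 2) ^ 2

/-! ## The resolved conifold -/

/-- The coordinates `w` on `ℂ⁴`, in which the conifold `∑ z_j² = 0` is the set of the singular
matrices with rows `(w 0, w 1)` and `(w 2, w 3)`. -/
def wCoord (z : C4) : Fin 4 → ℂ :=
  ![z 0 + I * z 1, -z 2 + I * z 3, z 2 + I * z 3, z 0 - I * z 1]

/-- The point of `ℂ⁴` with coordinates `w`. -/
def ofW (w : Fin 4 → ℂ) : C4 :=
  !₂[(w 0 + w 3) / 2, (w 0 - w 3) / (2 * I), (w 2 - w 1) / 2, (w 1 + w 2) / (2 * I)]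

theorem wCoord_ofW (w : Fin 4 → ℂ) : wCoord (ofW w) = w := by
  ext j
  fin_cases j <;> simp [wCoord, ofW] <;> field_simp <;> ring

theorem ofW_wCoord (z : C4) : ofW (wCoord z) = z := by
  ext j
  fin_cases j <;> simp [wCoord, ofW] <;> field_simp <;> ring

/-- The resolved conifold: the points `([u : v], z)` of `ℂP¹ × ℂ⁴` such that `w 0 * v - w 1 * u = 0`
and `w 2 * v - w 3 * u = 0`. -/
def ResolvedConifold : Type :=
  {q : CP1 × C4 // wCoord q.2 0 * q.1.hom 1 - wCoord q.2 1 * q.1.hom 0 = 0 ∧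
    wCoord q.2 2 * q.1.hom 1 - wCoord q.2 3 * q.1.hom 0 = 0}

namespace ResolvedConifold

instance : TopologicalSpace ResolvedConifold := instTopologicalSpaceSubtype

/-- The projection to the projective line. -/
def proj₁ (q : ResolvedConifold) : CP1 := q.1.1

/-- The projection to `ℂ⁴`. -/
def proj₂ (q : ResolvedConifold) : C4 := q.1.2

/-- The zero section. -/
def zeroSection : Set ResolvedConifold := {q | q.proj₂ = 0}

/-- The rank two bundle `𝒪(-1) ⊕ 𝒪(-1)` is trivialized by the frame `affineVec i c` of the
tautological line over the point with affine coordinate `c`. -/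
def bundleVec (i : Fin 2) (y : ℂ × ℂ × ℂ) : C4 :=
  ofW ![y.2.1 * affineVec i y.1 0, y.2.1 * affineVec i y.1 1,
    y.2.2 * affineVec i y.1 0, y.2.2 * affineVec i y.1 1]

/-- The inverse of a chart of the resolved conifold. -/
def ofChart (i : Fin 2) (y : ℂ × ℂ × ℂ) : ResolvedConifold :=
  ⟨((CP1.chart i).symm y.1, bundleVec i y), by
    obtain ⟨a, ha, h⟩ := CP1.exists_hom_mk _ (affineVec_ne_zero i y.1)
    change wCoord (bundleVec i y) 0 * (CP1.mk _ (affineVec_ne_zero i y.1)).hom 1 -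
      wCoord (bundleVec i y) 1 * (CP1.mk _ (affineVec_ne_zero i y.1)).hom 0 = 0 ∧
      wCoord (bundleVec i y) 2 * (CP1.mk _ (affineVec_ne_zero i y.1)).hom 1 -
      wCoord (bundleVec i y) 3 * (CP1.mk _ (affineVec_ne_zero i y.1)).hom 0 = 0
    rw [h, bundleVec, wCoord_ofW]
    constructor <;> simp <;> ring⟩

/-- The coordinates of a point of the resolved conifold: the affine coordinate on the projective
line, and two coordinates in the fibre. -/
def toChart (i : Fin 2) (q : ResolvedConifold) : ℂ × ℂ × ℂ :=
  (CP1.chart i q.proj₁, wCoord q.proj₂ (Fin.castAdd 2 i), wCoord q.proj₂ (Fin.natAdd 2 i))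

theorem toChart_ofChart (i : Fin 2) (y : ℂ × ℂ × ℂ) : toChart i (ofChart i y) = y := by
  refine Prod.ext ((CP1.chart i).right_inv (mem_univ y.1)) (Prod.ext ?_ ?_)
  · change wCoord (bundleVec i y) (Fin.castAdd 2 i) = y.2.1
    rw [bundleVec, wCoord_ofW]
    fin_cases i <;> simp [affineVec, Fin.castAdd]
  · change wCoord (bundleVec i y) (Fin.natAdd 2 i) = y.2.2
    rw [bundleVec, wCoord_ofW]
    fin_cases i <;> simp [affineVec, Fin.natAdd]

theorem ofChart_toChart (i : Fin 2) (q : ResolvedConifold) (hq : q.proj₁.hom i ≠ 0) :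
    ofChart i (toChart i q) = q := by
  obtain ⟨⟨p, z⟩, h1, h2⟩ := q
  refine Subtype.ext (Prod.ext ((CP1.chart i).left_inv hq) ?_)
  change bundleVec i (CP1.chart i p, wCoord z _, wCoord z _) = z
  rw [← ofW_wCoord z, bundleVec, wCoord_ofW]
  congr 1
  change p.hom i ≠ 0 at hq
  have hc : CP1.chart i p = p.hom (i + 1) / p.hom i := rfl
  simp only at h1 h2
  rw [hc]
  ext j
  fin_cases i <;> fin_cases j <;>
    simp [affineVec, Fin.castAdd, Fin.natAdd] at hq ⊢ <;> field_simp <;>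
    grind

theorem continuous_proj₁ : Continuous proj₁ := continuous_fst.comp continuous_subtype_val

theorem continuous_proj₂ : Continuous proj₂ := continuous_snd.comp continuous_subtype_val

theorem continuous_wCoord (j : Fin 4) : Continuous fun z => wCoord z j := by
  fin_cases j <;> simp [wCoord] <;> fun_prop

theorem contDiff_bundleVec (i : Fin 2) : ContDiff ℂ ⊤ (bundleVec i) := by
  rw [contDiff_euclidean]
  intro j
  fin_cases i <;> fin_cases j <;> simp [bundleVec, ofW, affineVec] <;> fun_prop

/-- The chart of the resolved conifold over an affine chart of the projective line. -/
def chart (i : Fin 2) : OpenPartialHomeomorph ResolvedConifold (ℂ × ℂ × ℂ) where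
  toFun := toChart i
  invFun := ofChart i
  source := {q | q.proj₁.hom i ≠ 0}
  target := univ
  map_source' _ _ := mem_univ _
  map_target' y _ := (CP1.chart i).map_target (mem_univ y.1)
  left_inv' q hq := ofChart_toChart i q hq
  right_inv' y _ := toChart_ofChart i y
  open_source := (CP1.isOpen_ne i).preimage continuous_proj₁
  open_target := isOpen_univ
  continuousOn_toFun := by
    refine ContinuousOn.prodMk ?_ (Continuous.continuousOn ?_)
    · exact (CP1.chart i).continuousOn.comp continuous_proj₁.continuousOn fun q hq => hq
    · exact ((continuous_wCoord _).comp continuous_proj₂).prodMk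
        ((continuous_wCoord _).comp continuous_proj₂)
  continuousOn_invFun := by
    refine Continuous.continuousOn (Continuous.subtype_mk (Continuous.prodMk ?_ ?_) _)
    · exact (continuousOn_univ.1 (CP1.chart i).continuousOn_symm).comp continuous_fst
    · exact (contDiff_bundleVec i).continuous

instance : ChartedSpace (ℂ × ℂ × ℂ) ResolvedConifold where
  atlas := range chart
  chartAt q := chart q.proj₁.index
  mem_chart_source q := q.proj₁.hom_index_ne_zero
  chart_mem_atlas _ := mem_range_self _

theorem contDiffOn_transition (i j : Fin 2) :
    ContDiffOn ℂ ⊤ (chart j ∘ (chart i).symm)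
      ((chart i).symm ≫ₕ chart j).source := by
  have hs : ∀ y ∈ ((chart i).symm ≫ₕ chart j).source, affineVec i y.1 j ≠ 0 := by
    rintro y ⟨-, hy⟩
    obtain ⟨a, ha, h⟩ := CP1.exists_hom_mk _ (affineVec_ne_zero i y.1)
    change (CP1.mk _ (affineVec_ne_zero i y.1)).hom j ≠ 0 at hy
    rw [h] at hy
    exact right_ne_zero_of_mul hy
  have hf : ∀ y : ℂ × ℂ × ℂ, (chart j ∘ (chart i).symm) y =
      (affineVec i y.1 (j + 1) / affineVec i y.1 j,
        y.2.1 * affineVec i y.1 j, y.2.2 * affineVec i y.1 j) := by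
    intro y
    obtain ⟨a, ha, h⟩ := CP1.exists_hom_mk _ (affineVec_ne_zero i y.1)
    refine Prod.ext ?_ (Prod.ext ?_ ?_)
    · change (CP1.mk _ (affineVec_ne_zero i y.1)).hom (j + 1) /
        (CP1.mk _ (affineVec_ne_zero i y.1)).hom j = _
      rw [h]
      exact mul_div_mul_left _ _ ha
    · change wCoord (bundleVec i y) (Fin.castAdd 2 j) = y.2.1 * affineVec i y.1 j
      rw [bundleVec, wCoord_ofW]
      fin_cases j <;> simp [Fin.castAdd]
    · change wCoord (bundleVec i y) (Fin.natAdd 2 j) = y.2.2 * affineVec i y.1 j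
      rw [bundleVec, wCoord_ofW]
      fin_cases j <;> simp [Fin.natAdd]
  have hc : ∀ l : Fin 2, ContDiff ℂ ⊤ fun y : ℂ × ℂ × ℂ => affineVec i y.1 l := by
    intro l
    by_cases h : l = i <;> simp [affineVec, h] <;> fun_prop
  refine ContDiffOn.congr ?_ fun y _ => hf y
  refine ContDiffOn.prodMk ((hc _).contDiffOn.div (hc _).contDiffOn hs) ?_
  exact ((contDiff_snd.fst.mul (hc _)).prodMk (contDiff_snd.snd.mul (hc _))).contDiffOn

/-- The resolved conifold is a complex manifold. -/
instance : IsManifold 𝓘(ℂ, ℂ × ℂ × ℂ) ω ResolvedConifold := by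
  refine isManifold_of_contDiffOn _ _ _ ?_
  rintro _ _ ⟨i, rfl⟩ ⟨j, rfl⟩
  simpa using contDiffOn_transition i j

/-- The resolved conifold is a smooth manifold. -/
instance : IsManifold 𝓘(ℝ, ℂ × ℂ × ℂ) ∞ ResolvedConifold := by
  refine isManifold_of_contDiffOn _ _ _ ?_
  rintro _ _ ⟨i, rfl⟩ ⟨j, rfl⟩
  simpa using ((contDiffOn_transition i j).restrict_scalars ℝ).of_le le_top

/-- The complex structure: multiplication by `i` in the (holomorphic) charts. -/
def J (q : ResolvedConifold) :
    TangentSpace 𝓘(ℝ, ℂ × ℂ × ℂ) q →L[ℝ] TangentSpace 𝓘(ℝ, ℂ × ℂ × ℂ) q :=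
  (I • ContinuousLinearMap.id ℝ (ℂ × ℂ × ℂ) : (ℂ × ℂ × ℂ) →L[ℝ] (ℂ × ℂ × ℂ))

/-- The Kähler metric `π₁^* g_FS + π₂^* g_st`. -/
def metric (q : ResolvedConifold) (X Y : TangentSpace 𝓘(ℝ, ℂ × ℂ × ℂ) q) : ℝ :=
  fubiniStudy q.proj₁ (mfderiv 𝓘(ℝ, ℂ × ℂ × ℂ) 𝓘(ℝ, ℂ) proj₁ q X)
    (mfderiv 𝓘(ℝ, ℂ × ℂ × ℂ) 𝓘(ℝ, ℂ) proj₁ q Y) +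
  realInner (V := C4) (mfderiv 𝓘(ℝ, ℂ × ℂ × ℂ) 𝓘(ℝ, C4) proj₂ q X)
    (mfderiv 𝓘(ℝ, ℂ × ℂ × ℂ) 𝓘(ℝ, C4) proj₂ q Y)

/-- The pullback of a 2-form on `ℂ⁴` by `π₂`. Away from the zero section `π₂` is a
biholomorphism onto the conifold without its singular point, and this is the pushforward by
`π₂⁻¹` of the restriction of the form to the conifold. -/
def lift (β : C4 → C4 [⋀^Fin 2]→L[ℝ] ℝ) : Form (ℂ × ℂ × ℂ) ResolvedConifold 2 := fun q =>
  (β q.proj₂).compContinuousLinearMap (mfderiv 𝓘(ℝ, ℂ × ℂ × ℂ) 𝓘(ℝ, C4) proj₂ q)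

end ResolvedConifold

/-- The conifold transition of a subset of `T^*S³`: the closure in the resolved conifold of
`π₂⁻¹(F(N) ∖ {0})`. -/
def conifoldTransition (N : Set (R4 × R4)) : Set ResolvedConifold :=
  closure (ResolvedConifold.proj₂ ⁻¹' (contraction '' N \ {0}))

/-- The form `(π₂⁻¹)_* (Φ_ε)_* (∑ dx_j ∧ dp_j)` on the resolved conifold. -/
def perturbedForm (ξ : R4 → R4) (ε : ℝ) : Form (ℂ × ℂ × ℂ) ResolvedConifold 2 :=
  ResolvedConifold.lift (pushforward (shear ξ ε) fun _ => stdForm)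

end Conifold

end

/-!
On the conifold `|x| = |p|` and `x ⟂ p`, so `F` maps the fibre of `N*_{k,ε}` over `k(t)` to the
points with `x = |p| k(t)`, and there `|p| ≥ ε`. The image is closed and avoids the singular
point. Hence the conifold transition is its preimage under `π₂`, and near each of its points it
is cut out by three regular equations in conical coordinates of `ℝ⁴` adapted to the cone over
`k`.

The field `ξ` is homogeneous of degree zero outside a small ball. Its derivative along `k` can
be prescribed so that the antisymmetric part is only a rotation of norm at most `1` in the plane
of `k` and `k'`, which gives `‖curl ξ‖ ≤ 1 / r` at `r k(t)`. As `Φ_ε*ω(Z, iZ)` is `|Z|² - ε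
⟨curl ξ(x) Re Z, Im Z⟩` and `r = |p| ≥ ε` on the conifold transition, the form is tame near it.

Since `ξ = k'` on the cone over `k`, the map `Φ_ε⁻¹` carries `F(N*_{k,ε})` into the cone over
the conormal bundle of `k`, on which `ω` vanishes. Finally, `Φ_ε⁻¹ ∘ π₂` pulls the Liouville
form back to a primitive.
-/

noncomputable section

namespace Conifold

/-! ### Pullbacks of differential forms -/

section Pullback

variable {E F : Type*} [NormedAddCommGroup E] [NormedSpace ℝ E]
  [NormedAddCommGroup F] [NormedSpace ℝ F]

theorem continuous_alternatization (n : ℕ) : Continuous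
    (ContinuousMultilinearMap.alternatization (R := ℝ) (M := E) (N := ℝ) (ι := Fin n)) := by
  rw [ContinuousAlternatingMap.isEmbedding_toContinuousMultilinearMap.continuous_iff]
  simp only [Function.comp_def,
    ContinuousMultilinearMap.alternatization_apply_toContinuousMultilinearMap]
  exact continuous_finsetSum _ fun σ _ =>
    (ContinuousMultilinearMap.domDomCongrₗᵢ ℝ E ℝ σ).continuous.const_smul _

theorem alternatization_toContinuousMultilinearMap {n : ℕ} (f : E [⋀^Fin n]→L[ℝ] ℝ) :
    f.toContinuousMultilinearMap.alternatization = (n.factorial : ℝ) • f := by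
  ext v
  have h (σ : Equiv.Perm (Fin n)) : Equiv.Perm.sign σ • f (v ∘ σ) = f v := by
    rw [show f (v ∘ σ) = Equiv.Perm.sign σ • f v from f.toAlternatingMap.map_perm v σ, smul_smul,
      Int.units_mul_self, one_smul]
  simp [ContinuousMultilinearMap.alternatization_apply_apply, h, Fintype.card_perm]

-- Alternatization is a continuous retraction (up to the factor `n !`) of multilinear maps onto
-- alternating ones, which reduces the claim to the known smoothness for multilinear maps.
theorem contDiff_compContinuousLinearMap (n : ℕ) (r : WithTop ℕ∞) :
    ContDiff ℝ r fun x : (F [⋀^Fin n]→L[ℝ] ℝ) × (E →L[ℝ] F) =>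
      x.1.compContinuousLinearMap x.2 := by
  let A : ContinuousMultilinearMap ℝ (fun _ : Fin n => E) ℝ →L[ℝ] E [⋀^Fin n]→L[ℝ] ℝ :=
    ContinuousMultilinearMap.alternatization.toRealLinearMap (continuous_alternatization n)
  have h : (fun x : (F [⋀^Fin n]→L[ℝ] ℝ) × (E →L[ℝ] F) => x.1.compContinuousLinearMap x.2) =
      fun x => (n.factorial : ℝ)⁻¹ •
        A (ContinuousMultilinearMap.compContinuousLinearMapContinuousMultilinear ℝ
          (fun _ : Fin n => E) (fun _ => F) ℝ (fun _ => x.2) x.1.toContinuousMultilinearMap) := by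
    funext x
    rw [eq_inv_smul_iff₀ (by positivity), ← alternatization_toContinuousMultilinearMap]
    rfl
  rw [h]
  refine (A.contDiff.comp (ContDiff.clm_apply ?_ ?_)).const_smul _
  · exact (ContinuousMultilinearMap.contDiff _).comp (contDiff_pi.2 fun _ => contDiff_snd)
  · exact (ContinuousAlternatingMap.toContinuousMultilinearMapCLM (𝕜 := ℝ) (E := F) (F := ℝ)
      (ι := Fin n) ℝ).contDiff.comp contDiff_fst

theorem compContinuousLinearMap_pair (f : F [⋀^Fin 2]→L[ℝ] ℝ) (A : E →L[ℝ] F) (X Y : E) :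
    f.compContinuousLinearMap A ![X, Y] = f ![A X, A Y] := by
  refine congrArg f ?_
  ext i : 1
  fin_cases i <;> rfl

variable {M : Type*} [TopologicalSpace M] [ChartedSpace E M]

/-- The pullback by `f : M → F` of a differential form on the vector space `F`. -/
def Form.pullback {n : ℕ} (f : M → F) (β : F → F [⋀^Fin n]→L[ℝ] ℝ) : Form E M n := fun q =>
  (β (f q)).compContinuousLinearMap (mfderiv 𝓘(ℝ, E) 𝓘(ℝ, F) f q)

theorem Form.pullback_pair (f : M → F) (β : F → F [⋀^Fin 2]→L[ℝ] ℝ) (q : M)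
    (X Y : TangentSpace 𝓘(ℝ, E) q) :
    Form.pullback f β q ![X, Y] =
      β (f q) ![mfderiv 𝓘(ℝ, E) 𝓘(ℝ, F) f q X, mfderiv 𝓘(ℝ, E) 𝓘(ℝ, F) f q Y] :=
  compContinuousLinearMap_pair (E := E) (F := F) _ _ _ _

variable {n : ℕ} {f : M → F} {β : F → F [⋀^Fin n]→L[ℝ] ℝ} {e : OpenPartialHomeomorph M E}

theorem mfderiv_eq_fderiv_comp_mfderiv (he : e ∈ IsManifold.maximalAtlas 𝓘(ℝ, E) ∞ M) {q : M}
    (hq : q ∈ e.source) (hf : DifferentiableAt ℝ (f ∘ e.symm) (e q)) :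
    mfderiv 𝓘(ℝ, E) 𝓘(ℝ, F) f q =
      (fderiv ℝ (f ∘ e.symm) (e q)).comp (mfderiv 𝓘(ℝ, E) 𝓘(ℝ, E) e q) := by
  have hfe : f =ᶠ[𝓝 q] (f ∘ e.symm) ∘ e := by
    filter_upwards [e.open_source.mem_nhds hq] with x hx
    simp only [Function.comp_apply, e.left_inv hx]
  rw [← mfderiv_eq_fderiv, hfe.mfderiv_eq]
  exact mfderiv_comp q hf.mdifferentiableAt
    ((contMDiffAt_of_mem_maximalAtlas he hq).mdifferentiableAt (by simp))

theorem contDiffOn_comp_symm (hf : ContMDiff 𝓘(ℝ, E) 𝓘(ℝ, F) ∞ f)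
    (he : e ∈ IsManifold.maximalAtlas 𝓘(ℝ, E) ∞ M) : ContDiffOn ℝ ∞ (f ∘ e.symm) e.target :=
  (hf.comp_contMDiffOn (contMDiffOn_symm_of_mem_maximalAtlas he)).contDiffOn

theorem Form.inChart_pullback (hf : ContMDiff 𝓘(ℝ, E) 𝓘(ℝ, F) ∞ f)
    (he : e ∈ IsManifold.maximalAtlas 𝓘(ℝ, E) ∞ M) {y : E} (hy : y ∈ e.target) :
    (Form.pullback f β).inChart e y =
      (β (f (e.symm y))).compContinuousLinearMap (fderiv ℝ (f ∘ e.symm) y) := by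
  have chain : fderiv ℝ (f ∘ e.symm) y = (mfderiv 𝓘(ℝ, E) 𝓘(ℝ, F) f (e.symm y)).comp
      (mfderiv 𝓘(ℝ, E) 𝓘(ℝ, E) e.symm y) := by
    rw [← mfderiv_eq_fderiv]
    exact mfderiv_comp y (hf.mdifferentiableAt (by simp))
      ((contMDiffAt_symm_of_mem_maximalAtlas he hy).mdifferentiableAt (by simp))
  rw [chain]
  rfl

variable [IsManifold 𝓘(ℝ, E) ∞ M]

theorem Form.smoothOn_pullback (hf : ContMDiff 𝓘(ℝ, E) 𝓘(ℝ, F) ∞ f) (hβ : ContDiff ℝ ∞ β)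
    (U : Set M) : (Form.pullback f β : Form E M n).SmoothOn U := by
  intro e he
  have he := IsManifold.subset_maximalAtlas (I := 𝓘(ℝ, E)) (n := ∞) he
  have hfe := contDiffOn_comp_symm hf he
  have h : ContDiffOn ℝ ∞ (fun y => (β ((f ∘ e.symm) y)).compContinuousLinearMap
      (fderiv ℝ (f ∘ e.symm) y)) e.target :=
    (contDiff_compContinuousLinearMap n ∞).comp_contDiffOn
      ((hβ.comp_contDiffOn hfe).prodMk (hfe.fderiv_of_isOpen e.open_target (by simp)))
  exact (h.congr fun y hy => Form.inChart_pullback hf he hy).mono inter_subset_left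

theorem Form.d_pullback (hf : ContMDiff 𝓘(ℝ, E) 𝓘(ℝ, F) ∞ f) (hβ : ContDiff ℝ ∞ β) (q : M) :
    (Form.pullback f β).d q = (Form.pullback f (extDeriv β) : Form E M (n + 1)) q := by
  set e := chartAt E q with he_def
  have he : e ∈ IsManifold.maximalAtlas 𝓘(ℝ, E) ∞ M := IsManifold.chart_mem_maximalAtlas q
  have hq : q ∈ e.source := mem_chart_source E q
  have heq : e q ∈ e.target := e.map_source hq
  have hfe : ContDiffAt ℝ ∞ (f ∘ e.symm) (e q) :=
    (contDiffOn_comp_symm hf he).contDiffAt (e.open_target.mem_nhds heq)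
  have hloc : (Form.pullback f β).inChart e =ᶠ[𝓝 (e q)] fun y =>
      (β ((f ∘ e.symm) y)).compContinuousLinearMap (fderiv ℝ (f ∘ e.symm) y) :=
    Filter.eventually_of_mem (e.open_target.mem_nhds heq)
      fun y hy => Form.inChart_pullback hf he hy
  rw [Form.d, ← he_def, hloc.extDeriv_eq, extDeriv_pullback (hβ.differentiable (by simp) _) hfe
    (by rw [minSmoothness_of_isRCLikeNormedField]; exact WithTop.coe_le_coe.2 le_top),
    Form.pullback, mfderiv_eq_fderiv_comp_mfderiv he hq (hfe.differentiableAt (by simp)),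
    Function.comp_apply, e.left_inv hq]
  rfl

theorem Form.exactOn_pullback_extDeriv (hf : ContMDiff 𝓘(ℝ, E) 𝓘(ℝ, F) ∞ f)
    (hβ : ContDiff ℝ ∞ β) (U : Set M) :
    (Form.pullback f (extDeriv β) : Form E M (n + 1)).ExactOn U :=
  ⟨Form.pullback f β, Form.smoothOn_pullback hf hβ U, fun q _ => (Form.d_pullback hf hβ q).symm⟩

end Pullback

section Tame

variable {E : Type*} [NormedAddCommGroup E] [NormedSpace ℝ E]
  {M : Type*} [TopologicalSpace M] [ChartedSpace E M]

theorem Form.UniformlyTameOn.exists_ne_zero {α : Form E M 2}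
    {J : ∀ q : M, TangentSpace 𝓘(ℝ, E) q →L[ℝ] TangentSpace 𝓘(ℝ, E) q}
    {g : ∀ q : M, TangentSpace 𝓘(ℝ, E) q → TangentSpace 𝓘(ℝ, E) q → ℝ} {U : Set M}
    (hα : α.UniformlyTameOn J g U) {q : M} (hq : q ∈ U) {X : TangentSpace 𝓘(ℝ, E) q}
    (hX : 0 < g q X X) : ∃ Y, α q ![X, Y] ≠ 0 := by
  obtain ⟨C, hC, hα⟩ := hα
  have hC0 : 0 < C := one_pos.trans_le hC
  exact ⟨J q X, ((mul_pos (inv_pos.2 hC0) hX).trans_le (hα q hq X).1).ne'⟩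

end Tame

/-! ### Regular level sets and tangent vectors -/

section Submanifold

variable {E F : Type*} [NormedAddCommGroup E] [NormedSpace ℝ E]
  [NormedAddCommGroup F] [NormedSpace ℝ F]

theorem exists_openPartialHomeomorph_of_contDiffOn [CompleteSpace E] {h : E → F} {O : Set E}
    (hO : IsOpen O) (hh : ContDiffOn ℝ ∞ h O) {a : E} (ha : a ∈ O) {h' : E ≃L[ℝ] F}
    (hh' : HasFDerivAt h (h' : E →L[ℝ] F) a) :
    ∃ e : OpenPartialHomeomorph E F, a ∈ e.source ∧ e.source ⊆ O ∧ (e : E → F) = h ∧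
      ContDiffOn ℝ ∞ e.symm e.target := by
  have hAt (y : E) (hy : y ∈ O) : ContDiffAt ℝ ∞ h y := hh.contDiffAt (hO.mem_nhds hy)
  let e₀ := (hAt a ha).toOpenPartialHomeomorph h hh' (by simp)
  let S : Set E := O ∩ fderiv ℝ h ⁻¹' (range ((↑) : (E ≃L[ℝ] F) → E →L[ℝ] F))
  have hS : IsOpen S := (hh.continuousOn_fderiv_of_isOpen hO (by simp)).isOpen_inter_preimage hO
    ContinuousLinearEquiv.isOpen
  have hsource : (e₀.restrOpen S hS).source = e₀.source ∩ S := e₀.restrOpen_source S hS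
  refine ⟨e₀.restrOpen S hS, ?_, ?_, rfl, fun b hb => ?_⟩
  · rw [hsource]
    exact ⟨(hAt a ha).mem_toOpenPartialHomeomorph_source hh' (by simp), ha, h', hh'.fderiv.symm⟩
  · rw [hsource]
    exact fun y hy => hy.2.1
  · obtain ⟨-, hb, f', hf'⟩ := hsource ▸ (e₀.restrOpen S hS).map_target hb
    have hd : HasFDerivAt h (f' : E →L[ℝ] F) ((e₀.restrOpen S hS).symm b) := by
      rw [hf']
      exact ((hAt _ hb).differentiableAt (by simp)).hasFDerivAt
    exact ((e₀.restrOpen S hS).contDiffAt_symm ‹_› hd (hAt _ hb)).contDiffWithinAt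

theorem exists_straightening [FiniteDimensional ℝ E] {g : E → F} {O : Set E} (hO : IsOpen O)
    (hg : ContDiffOn ℝ ∞ g O) {a : E} (ha : a ∈ O)
    (hsurj : Function.Surjective (fderiv ℝ g a)) :
    ∃ h : OpenPartialHomeomorph E E, a ∈ h.source ∧ h.source ⊆ O ∧
      ContDiffOn ℝ ∞ h h.source ∧ ContDiffOn ℝ ∞ h.symm h.target ∧
      ∀ y, fderiv ℝ g a (h y) = g y := by
  set g' := fderiv ℝ g a
  have hg' : HasFDerivAt g g' a :=
    ((hg.contDiffAt (hO.mem_nhds ha)).differentiableAt (by simp)).hasFDerivAt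
  have : FiniteDimensional ℝ F := Module.Finite.of_surjective (g' : E →ₗ[ℝ] F) hsurj
  obtain ⟨R', hR'⟩ := (g' : E →ₗ[ℝ] F).exists_rightInverse_of_surjective
    (LinearMap.range_eq_top.2 hsurj)
  let R : F →L[ℝ] E := LinearMap.toContinuousLinearMap R'
  have hR (v : F) : g' (R v) = v := DFunLike.congr_fun hR' v
  let H : E → E := fun y => y + R (g y - g' y)
  have hH : ContDiffOn ℝ ∞ H O :=
    contDiffOn_id.add (R.contDiff.comp_contDiffOn (hg.sub g'.contDiff.contDiffOn))
  have hH' : HasFDerivAt H (ContinuousLinearEquiv.refl ℝ E : E →L[ℝ] E) a := by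
    refine ((hasFDerivAt_id a).add
      (R.hasFDerivAt.comp a (hg'.sub g'.hasFDerivAt))).congr_fderiv ?_
    ext v
    simp
  obtain ⟨h, hah, hhO, hhH, hhs⟩ := exists_openPartialHomeomorph_of_contDiffOn hO hH ha hH'
  refine ⟨h, hah, hhO, hhH ▸ hH.mono hhO, hhs, fun y => ?_⟩
  simp only [hhH, H, map_add, map_sub, hR]
  abel

variable {M : Type*} [TopologicalSpace M] [ChartedSpace E M]

theorem exists_slice_chart_of_regular_equation [FiniteDimensional ℝ E]
    [IsManifold 𝓘(ℝ, E) ∞ M] {L U : Set M} {q : M} (hU : IsOpen U) (hq : q ∈ U) {G : M → F}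
    (hG : ContMDiffOn 𝓘(ℝ, E) 𝓘(ℝ, F) ∞ G U)
    (hsurj : Function.Surjective (mfderiv 𝓘(ℝ, E) 𝓘(ℝ, F) G q))
    (hL : ∀ x ∈ U, x ∈ L ↔ G x = 0) :
    ∃ e ∈ IsManifold.maximalAtlas 𝓘(ℝ, E) ∞ M, q ∈ e.source ∧
      ∃ V : Submodule ℝ E, Module.finrank ℝ V + Module.finrank ℝ F = Module.finrank ℝ E ∧
        e.source ∩ L = e.source ∩ e ⁻¹' V := by
  set c := chartAt E q
  have hc : c ∈ IsManifold.maximalAtlas 𝓘(ℝ, E) ∞ M := IsManifold.chart_mem_maximalAtlas q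
  have hqc : q ∈ c.source := mem_chart_source E q
  set O : Set E := c.target ∩ c.symm ⁻¹' U
  have hO : IsOpen O := c.isOpen_inter_preimage_symm hU
  have hqO : c q ∈ O := ⟨c.map_source hqc, by rwa [mem_preimage, c.left_inv hqc]⟩
  have hg : ContDiffOn ℝ ∞ (G ∘ c.symm) O := (hG.comp
    ((contMDiffOn_symm_of_mem_maximalAtlas hc).mono inter_subset_left) fun _ hy => hy.2).contDiffOn
  have hsurj' : Function.Surjective (fderiv ℝ (G ∘ c.symm) (c q)) := by
    rw [mfderiv_eq_fderiv_comp_mfderiv hc hqc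
      ((hg.contDiffAt (hO.mem_nhds hqO)).differentiableAt (by simp))] at hsurj
    exact Function.Surjective.of_comp hsurj
  obtain ⟨h, hqh, hhO, hh, hhs, hgh⟩ := exists_straightening hO hg hqO hsurj'
  refine ⟨c ≫ₕ h, OpenPartialHomeomorph.mem_maximalAtlas_of_contMDiffOn _ ?_ ?_, ⟨hqc, hqh⟩,
    LinearMap.ker (fderiv ℝ (G ∘ c.symm) (c q) : E →ₗ[ℝ] F), ?_, ?_⟩
  · exact hh.contMDiffOn.comp ((contMDiffOn_of_mem_maximalAtlas hc).mono inter_subset_left)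
      fun _ hx => hx.2
  · exact (contMDiffOn_symm_of_mem_maximalAtlas hc).comp
      (hhs.contMDiffOn.mono inter_subset_left) fun _ hy => hy.2
  · rw [add_comm, ← LinearMap.finrank_range_add_finrank_ker
      (fderiv ℝ (G ∘ c.symm) (c q) : E →ₗ[ℝ] F), LinearMap.range_eq_top.2 hsurj', finrank_top]
  · refine Set.ext fun x => and_congr_right fun hx => ?_
    have hxU : x ∈ U := by simpa [c.left_inv hx.1] using (hhO hx.2).2
    have hGx := hgh (c x)
    rw [Function.comp_apply, c.left_inv hx.1] at hGx
    rw [hL x hxU, ← hGx]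
    rfl

theorem exists_hasDerivAt_of_mem_tangentVectors {L : Set M} {q : M} {X : TangentSpace 𝓘(ℝ, E) q}
    (hX : X ∈ tangentVectors E L q) {f : M → F}
    (hf : MDifferentiableAt 𝓘(ℝ, E) 𝓘(ℝ, F) f q) :
    ∃ z : ℝ → F, z 0 = f q ∧ HasDerivAt z (mfderiv 𝓘(ℝ, E) 𝓘(ℝ, F) f q X) 0 ∧
      ∀ᶠ s in 𝓝 0, z s ∈ f '' L := by
  obtain ⟨γ, rfl, hγ, hγL, rfl⟩ := hX
  refine ⟨f ∘ γ, rfl, ?_, hγL.mono fun s hs => mem_image_of_mem f hs⟩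
  have hz : HasMFDerivAt 𝓘(ℝ, ℝ) 𝓘(ℝ, F) (f ∘ γ) 0 _ :=
    hf.hasMFDerivAt.comp 0 (hγ.mdifferentiableAt (by simp)).hasMFDerivAt
  have hasDerivAt_of (T : ℝ →L[ℝ] F) (h : HasFDerivAt (f ∘ γ) T 0) :
      HasDerivAt (f ∘ γ) (T 1) 0 := h.hasDerivAt
  exact hasDerivAt_of _ hz.hasFDerivAt

end Submanifold

/-! ### Extension of jets -/

section Jets

theorem norm_finsum_smul_sub_le {E F ι : Type*} [NormedAddCommGroup E] [NormedSpace ℝ E]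
    [FiniteDimensional ℝ E] [NormedAddCommGroup F] [NormedSpace ℝ F]
    (ρ : SmoothPartitionOfUnity ι 𝓘(ℝ, E) E univ) {x : E} {g : ι → F} {y : F} {c : ℝ}
    (h : ∀ i ∈ ρ.finsupport x, ‖g i - y‖ ≤ c) : ‖∑ᶠ i, ρ i x • g i - y‖ ≤ c := by
  rw [← mem_closedBall_iff_norm]
  refine ρ.finsum_smul_mem_convex (g := fun i _ => g i) (mem_univ x) (fun i hi => ?_)
    (convex_closedBall y c)
  exact mem_closedBall_iff_norm.2 (h i ((ρ.mem_finsupport x).2 hi))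

theorem exists_contDiff_of_local_jets {E F ι : Type*} [NormedAddCommGroup E] [NormedSpace ℝ E]
    [FiniteDimensional ℝ E] [NormedAddCommGroup F] [NormedSpace ℝ F]
    (p : ι → E) (a : ι → F) (b : ι → E →L[ℝ] F)
    (hloc : ∀ x, ∃ U : Set E, IsOpen U ∧ x ∈ U ∧ ∃ g : E → F, ContDiffOn ℝ ∞ g U ∧
      ∀ t, p t ∈ U → g (p t) = a t ∧ HasFDerivAt g (b t) (p t)) :
    ∃ g : E → F, ContDiff ℝ ∞ g ∧ ∀ t, g (p t) = a t ∧ HasFDerivAt g (b t) (p t) := by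
  choose U hU hxU g hg hgp using hloc
  obtain ⟨ρ, hρ⟩ := SmoothPartitionOfUnity.exists_isSubordinate 𝓘(ℝ, E) (isClosed_univ (X := E))
    U hU fun x _ => mem_iUnion.2 ⟨x, hxU x⟩
  refine ⟨fun x => ∑ᶠ i, ρ i x • g i x,
    (hρ.contMDiff_finsum_smul hU fun i => (hg i).contMDiffOn).contDiff, fun t => ?_⟩
  have hjet (i) (hi : i ∈ ρ.fintsupport (p t)) : g i (p t) = a t ∧ HasFDerivAt (g i) (b t) (p t) :=
    hgp i t (hρ i ((ρ.mem_fintsupport_iff _ i).1 hi))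
  have hval : ∑ᶠ i, ρ i (p t) • g i (p t) = a t := by
    rw [← sub_eq_zero, ← norm_le_zero_iff]
    refine norm_finsum_smul_sub_le ρ fun i hi => ?_
    rw [(hjet i (ρ.finsupport_subset_fintsupport _ hi)).1, sub_self, norm_zero]
  refine ⟨hval, ?_⟩
  rw [hasFDerivAt_iff_isLittleO, Asymptotics.isLittleO_iff]
  intro c hc
  have hlocal : ∀ᶠ x in 𝓝 (p t), ∀ i ∈ ρ.fintsupport (p t),
      ‖g i x - (a t + b t (x - p t))‖ ≤ c * ‖x - p t‖ := by
    rw [Filter.eventually_all_finset]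
    intro i hi
    obtain ⟨hi_val, hi_deriv⟩ := hjet i hi
    rw [hasFDerivAt_iff_isLittleO, Asymptotics.isLittleO_iff] at hi_deriv
    filter_upwards [hi_deriv hc] with x hx
    rwa [hi_val, sub_sub] at hx
  filter_upwards [hlocal, ρ.eventually_finsupport_subset (p t)] with x hx hsub
  rw [hval, sub_sub]
  exact norm_finsum_smul_sub_le ρ fun i hi => hx i (hsub hi)

end Jets

/-! ### The Kähler form of `ℂ⁴` and fibrewise translations -/

/-- The real part `ℂ⁴ → ℝ⁴`, as a continuous linear map. -/
def rePartCLM : C4 →L[ℝ] R4 :=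
  LinearMap.toContinuousLinearMap
    { toFun := rePart
      map_add' := fun a b => by ext j; simp [rePart]
      map_smul' := fun a b => by ext j; simp [rePart] }

/-- The imaginary part `ℂ⁴ → ℝ⁴`, as a continuous linear map. -/
def imPartCLM : C4 →L[ℝ] R4 :=
  LinearMap.toContinuousLinearMap
    { toFun := imPart
      map_add' := fun a b => by ext j; simp [imPart]
      map_smul' := fun a b => by ext j; simp [imPart] }

/-- The identification `(x, p) ↦ x + i p`, as a continuous linear map. -/
def ofXPCLM : R4 × R4 →L[ℝ] C4 :=
  LinearMap.toContinuousLinearMap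
    { toFun := fun y => ofXP y.1 y.2
      map_add' := fun a b => by ext j; simp only [ofXP, Prod.fst_add, Prod.snd_add,
        PiLp.add_apply, ofReal_add]; ring
      map_smul' := fun a b => by ext j; simp only [ofXP, Prod.smul_fst, Prod.smul_snd,
        PiLp.smul_apply, smul_eq_mul, ofReal_mul, real_smul, RingHom.id_apply]; ring }

@[simp] theorem rePartCLM_apply (z : C4) : rePartCLM z = rePart z := rfl

@[simp] theorem imPartCLM_apply (z : C4) : imPartCLM z = imPart z := rfl

@[simp] theorem ofXPCLM_apply (y : R4 × R4) : ofXPCLM y = ofXP y.1 y.2 := rfl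

@[simp] theorem rePart_ofXP (x p : R4) : rePart (ofXP x p) = x := by
  ext j; simp [ofXP, rePart]

@[simp] theorem imPart_ofXP (x p : R4) : imPart (ofXP x p) = p := by
  ext j; simp [ofXP, imPart]

@[simp] theorem ofXP_rePart_imPart (z : C4) : ofXP (rePart z) (imPart z) = z := by
  ext j; apply Complex.ext <;> simp [ofXP, rePart, imPart]

@[simp] theorem rePart_I_smul (z : C4) : rePart (I • z) = -imPart z := by
  ext j; simp [rePart, imPart]

@[simp] theorem imPart_I_smul (z : C4) : imPart (I • z) = rePart z := by
  ext j; simp [rePart, imPart]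

theorem continuous_rePart : Continuous rePart := rePartCLM.continuous

theorem continuous_imPart : Continuous imPart := imPartCLM.continuous

theorem norm_sq_eq_rePart_add_imPart (z : C4) : ‖z‖ ^ 2 = ‖rePart z‖ ^ 2 + ‖imPart z‖ ^ 2 := by
  simp only [EuclideanSpace.norm_sq_eq, rePart, imPart, ← Finset.sum_add_distrib]
  refine Finset.sum_congr rfl fun j _ => ?_
  rw [← Complex.normSq_eq_norm_sq, Complex.normSq_apply, Real.norm_eq_abs, Real.norm_eq_abs, sq_abs,
    sq_abs, sq, sq]

theorem norm_imPart_le (z : C4) : ‖imPart z‖ ≤ ‖z‖ := by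
  refine le_of_sq_le_sq ?_ (norm_nonneg _)
  rw [norm_sq_eq_rePart_add_imPart z]
  exact le_add_of_nonneg_left (sq_nonneg _)

theorem stdForm_apply (X Y : C4) :
    stdForm ![X, Y] = inner ℝ (rePart X) (imPart Y) - inner ℝ (rePart Y) (imPart X) := by
  simp only [stdForm, ContinuousAlternatingMap.sum_apply, wedge_apply, PiLp.inner_apply,
    ← Finset.sum_sub_distrib]
  refine Finset.sum_congr rfl fun j _ => ?_
  simp only [dx, dp, rePart, imPart, ContinuousLinearMap.comp_apply, Real.inner_apply]
  rfl

/-- The Liouville form `∑ x_j dp_j`, a primitive of `stdForm`. -/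
def liouville : C4 →L[ℝ] C4 [⋀^Fin 1]→L[ℝ] ℝ :=
  ((ContinuousAlternatingMap.ofSubsingletonLIE (𝕜 := ℝ) (E := C4) (F := ℝ)
    (0 : Fin 1)).toContinuousLinearEquiv.toContinuousLinearMap) ∘L
    ((ContinuousLinearMap.compL ℝ C4 R4 ℝ).flip imPartCLM) ∘L (innerSL ℝ) ∘L rePartCLM

theorem liouville_apply (z : C4) (v : Fin 1 → C4) :
    liouville z v = inner ℝ (rePart z) (imPart (v 0)) := rfl

theorem extDeriv_liouville (z : C4) : extDeriv liouville z = stdForm := by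
  ext v
  have hv : v = ![v 0, v 1] := by ext i; fin_cases i <;> rfl
  have h (w : Fin 1 → C4) : fderiv ℝ (fun z => liouville z w) z =
      (ContinuousAlternatingMap.apply ℝ C4 ℝ w) ∘L liouville :=
    ((ContinuousAlternatingMap.apply ℝ C4 ℝ w) ∘L liouville).fderiv
  rw [extDeriv_apply liouville.differentiableAt, hv, stdForm_apply, Fin.sum_univ_two]
  simp only [h]
  simp [liouville_apply, Fin.removeNth, sub_eq_add_neg]

section Shear

variable {ξ : R4 → R4}

theorem hasFDerivAt_shear_symm (hξ : Differentiable ℝ ξ) (ε : ℝ) (z : C4) :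
    HasFDerivAt (shear ξ ε).symm (ofXPCLM ∘L
      (rePartCLM.prod (imPartCLM - ε • (fderiv ℝ ξ (rePart z) ∘L rePartCLM)))) z := by
  have h : HasFDerivAt (fun z => ξ (rePartCLM z)) (fderiv ℝ ξ (rePart z) ∘L rePartCLM) z :=
    (hξ (rePart z)).hasFDerivAt.comp z rePartCLM.hasFDerivAt
  exact ofXPCLM.hasFDerivAt.comp z
    (rePartCLM.hasFDerivAt.prodMk (imPartCLM.hasFDerivAt.sub (h.const_smul ε)))

theorem contDiff_shear_symm {n : WithTop ℕ∞} (hξ : ContDiff ℝ n ξ) (ε : ℝ) :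
    ContDiff ℝ n (shear ξ ε).symm :=
  ofXPCLM.contDiff.comp (rePartCLM.contDiff.prodMk
    (imPartCLM.contDiff.sub ((hξ.comp rePartCLM.contDiff).const_smul ε)))

theorem pushforward_shear_apply (hξ : Differentiable ℝ ξ) (ε : ℝ) (z X Y : C4) :
    pushforward (shear ξ ε) (fun _ => stdForm) z ![X, Y] =
      inner ℝ (rePart X) (imPart Y - ε • fderiv ℝ ξ (rePart z) (rePart Y)) -
      inner ℝ (rePart Y) (imPart X - ε • fderiv ℝ ξ (rePart z) (rePart X)) := by
  rw [pushforward, (hasFDerivAt_shear_symm hξ ε z).fderiv, compContinuousLinearMap_pair,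
    stdForm_apply]
  simp

/-- The pullback of the Liouville form by the inverse of `shear ξ ε`, a primitive of the
pushforward of `stdForm`. -/
def shearPrimitive (ξ : R4 → R4) (ε : ℝ) (z : C4) : C4 [⋀^Fin 1]→L[ℝ] ℝ :=
  (liouville ((shear ξ ε).symm z)).compContinuousLinearMap (fderiv ℝ (shear ξ ε).symm z)

theorem contDiff_shearPrimitive (hξ : ContDiff ℝ ∞ ξ) (ε : ℝ) :
    ContDiff ℝ ∞ (shearPrimitive ξ ε) :=
  (contDiff_compContinuousLinearMap 1 ∞).comp
    ((liouville.contDiff.comp (contDiff_shear_symm hξ ε)).prodMk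
      ((contDiff_shear_symm hξ ε).fderiv_right (by simp)))

theorem contDiff_pushforward_shear (hξ : ContDiff ℝ ∞ ξ) (ε : ℝ) :
    ContDiff ℝ ∞ (pushforward (shear ξ ε) fun _ => stdForm) :=
  (contDiff_compContinuousLinearMap 2 ∞).comp
    (contDiff_const.prodMk ((contDiff_shear_symm hξ ε).fderiv_right (by simp)))

theorem extDeriv_shearPrimitive (hξ : ContDiff ℝ ∞ ξ) (ε : ℝ) :
    extDeriv (shearPrimitive ξ ε) = pushforward (shear ξ ε) fun _ => stdForm := by
  funext z
  refine (extDeriv_pullback (r := ∞) liouville.differentiableAt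
    (contDiff_shear_symm hξ ε).contDiffAt
    (by rw [minSmoothness_of_isRCLikeNormedField]; exact WithTop.coe_le_coe.2 le_top)).trans ?_
  rw [extDeriv_liouville]
  rfl

/-- The antisymmetric part of the derivative of a vector field, without the factor `1 / 2`. -/
def curl (ξ : R4 → R4) (x : R4) : R4 →L[ℝ] R4 :=
  fderiv ℝ ξ x - (fderiv ℝ ξ x).adjoint

theorem continuous_curl (hξ : ContDiff ℝ 1 ξ) : Continuous (curl ξ) :=
  have h := hξ.continuous_fderiv one_ne_zero
  h.sub (ContinuousLinearMap.adjoint.continuous.comp h)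

theorem pushforward_shear_I_smul (hξ : Differentiable ℝ ξ) (ε : ℝ) (z X : C4) :
    pushforward (shear ξ ε) (fun _ => stdForm) z ![X, I • X] =
      ‖X‖ ^ 2 - ε * inner ℝ (curl ξ (rePart z) (rePart X)) (imPart X) := by
  rw [pushforward_shear_apply hξ, norm_sq_eq_rePart_add_imPart, rePart_I_smul, imPart_I_smul, curl]
  simp only [inner_sub_right, inner_neg_left, inner_smul_right, map_neg, smul_neg, inner_neg_right,
    real_inner_self_eq_norm_sq, _root_.sub_apply, inner_sub_left,
    ContinuousLinearMap.adjoint_inner_left]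
  rw [real_inner_comm (imPart X) (fderiv ℝ ξ (rePart z) (rePart X))]
  ring

theorem abs_pushforward_shear_sub_le (hξ : Differentiable ℝ ξ) (ε : ℝ) (z X : C4) :
    |pushforward (shear ξ ε) (fun _ => stdForm) z ![X, I • X] - ‖X‖ ^ 2| ≤
      |ε| * ‖curl ξ (rePart z)‖ / 2 * ‖X‖ ^ 2 := by
  rw [pushforward_shear_I_smul hξ, sub_sub_cancel_left, abs_neg, abs_mul, mul_div_assoc, mul_assoc]
  gcongr
  calc |inner ℝ (curl ξ (rePart z) (rePart X)) (imPart X)|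
      ≤ ‖curl ξ (rePart z)‖ * ‖rePart X‖ * ‖imPart X‖ :=
        (abs_real_inner_le_norm _ _).trans (by gcongr; exact ContinuousLinearMap.le_opNorm _ _)
    _ ≤ ‖curl ξ (rePart z)‖ / 2 * ‖X‖ ^ 2 := by
        rw [norm_sq_eq_rePart_add_imPart]
        nlinarith [mul_nonneg (norm_nonneg (curl ξ (rePart z)))
          (sq_nonneg (‖rePart X‖ - ‖imPart X‖))]

end Shear

/-! ### The geometry of the resolved conifold -/

/-- The coordinate `w_j`, as a continuous linear map. -/
def wCoordCLM (j : Fin 4) : C4 →L[ℝ] ℂ :=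
  LinearMap.toContinuousLinearMap
    { toFun := fun z => wCoord z j
      map_add' := fun a b => by fin_cases j <;> simp [wCoord] <;> ring
      map_smul' := fun a b => by fin_cases j <;> simp [wCoord] <;> ring }

@[simp] theorem wCoordCLM_apply (j : Fin 4) (z : C4) : wCoordCLM j z = wCoord z j := rfl

theorem sum_norm_sq_wCoord (z : C4) : ∑ j, ‖wCoord z j‖ ^ 2 = 2 * ‖z‖ ^ 2 := by
  simp only [EuclideanSpace.norm_sq_eq, Fin.sum_univ_four, ← Complex.normSq_eq_norm_sq,
    Complex.normSq_apply, wCoord]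
  simp
  ring

theorem sum_sq_eq_wCoord (z : C4) :
    ∑ j, z j ^ 2 = wCoord z 0 * wCoord z 3 - wCoord z 1 * wCoord z 2 := by
  simp only [Fin.sum_univ_four, wCoord, Matrix.cons_val]
  linear_combination (z 1 ^ 2 + z 3 ^ 2) * I_sq

theorem norm_rePart_eq_of_sum_sq_eq_zero {z : C4} (h : ∑ j, z j ^ 2 = 0) :
    ‖rePart z‖ = ‖imPart z‖ := by
  have h := congrArg Complex.re h
  simp only [Fin.sum_univ_four, pow_two, add_re, mul_re, zero_re] at h
  rw [← sq_eq_sq₀ (norm_nonneg _) (norm_nonneg _), EuclideanSpace.norm_sq_eq,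
    EuclideanSpace.norm_sq_eq]
  simp only [Fin.sum_univ_four, rePart, imPart, Real.norm_eq_abs, sq_abs]
  linarith

theorem inner_rePart_imPart_of_sum_sq_eq_zero {z : C4} (h : ∑ j, z j ^ 2 = 0) :
    inner ℝ (rePart z) (imPart z) = 0 := by
  have h := congrArg Complex.im h
  simp only [Fin.sum_univ_four, pow_two, add_im, mul_im, zero_im] at h
  simp only [PiLp.inner_apply, Fin.sum_univ_four, rePart, imPart, Real.inner_apply]
  linarith

theorem sum_mul_ofXP (z : C4) (a b : R4) : ∑ j, z j * ofXP a b j =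
    ((inner ℝ (rePart z) a - inner ℝ (imPart z) b : ℝ) : ℂ) +
      ((inner ℝ (rePart z) b + inner ℝ (imPart z) a : ℝ) : ℂ) * I := by
  simp only [PiLp.inner_apply, Fin.sum_univ_four]
  apply Complex.ext <;> simp [rePart, imPart, ofXP] <;> ring

namespace ResolvedConifold

theorem chart_mem_maximalAtlas (i : Fin 2) :
    chart i ∈ IsManifold.maximalAtlas 𝓘(ℝ, ℂ × ℂ × ℂ) ∞ ResolvedConifold :=
  IsManifold.subset_maximalAtlas (mem_range_self i)

theorem contDiff_real_bundleVec (i : Fin 2) : ContDiff ℝ ∞ (bundleVec i) :=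
  ((contDiff_bundleVec i).restrict_scalars ℝ).of_le le_top

theorem proj₂_eq_bundleVec {i : Fin 2} {q : ResolvedConifold} (hq : q ∈ (chart i).source) :
    q.proj₂ = bundleVec i (chart i q) := by
  conv_lhs => rw [← (chart i).left_inv hq]
  rfl

theorem proj₂_eq_bundleVec_index (q : ResolvedConifold) :
    q.proj₂ = bundleVec q.proj₁.index (chart q.proj₁.index q) :=
  proj₂_eq_bundleVec q.proj₁.hom_index_ne_zero

theorem contMDiff_proj₂ : ContMDiff 𝓘(ℝ, ℂ × ℂ × ℂ) 𝓘(ℝ, C4) ∞ proj₂ := by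
  intro q
  have hq : q ∈ (chart q.proj₁.index).source := q.proj₁.hom_index_ne_zero
  refine ((contDiff_real_bundleVec q.proj₁.index).contMDiff.contMDiffAt.comp q
    (contMDiffAt_of_mem_maximalAtlas (chart_mem_maximalAtlas _) hq)).congr_of_eventuallyEq ?_
  filter_upwards [(chart q.proj₁.index).open_source.mem_nhds hq] with q' hq'
  exact proj₂_eq_bundleVec hq'

theorem wCoord_bundleVec_castAdd (i : Fin 2) (y : ℂ × ℂ × ℂ) (l : Fin 2) :
    wCoord (bundleVec i y) (Fin.castAdd 2 l) = y.2.1 * affineVec i y.1 l := by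
  rw [bundleVec, wCoord_ofW]
  fin_cases l <;> rfl

theorem wCoord_bundleVec_natAdd (i : Fin 2) (y : ℂ × ℂ × ℂ) (l : Fin 2) :
    wCoord (bundleVec i y) (Fin.natAdd 2 l) = y.2.2 * affineVec i y.1 l := by
  rw [bundleVec, wCoord_ofW]
  fin_cases l <;> rfl

theorem sum_sq_bundleVec (i : Fin 2) (y : ℂ × ℂ × ℂ) : ∑ j, bundleVec i y j ^ 2 = 0 := by
  rw [sum_sq_eq_wCoord, bundleVec, wCoord_ofW]
  simp only [Matrix.cons_val]
  ring

theorem sum_sq_proj₂ (q : ResolvedConifold) : ∑ j, q.proj₂ j ^ 2 = 0 := by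
  rw [proj₂_eq_bundleVec_index]
  exact sum_sq_bundleVec _ _

theorem hasFDerivAt_bundleVec (i : Fin 2) (y : ℂ × ℂ × ℂ) :
    HasFDerivAt (bundleVec i) (fderiv ℝ (bundleVec i) y) y :=
  ((contDiff_real_bundleVec i).differentiable (by simp) y).hasFDerivAt

theorem fderiv_bundleVec_eq_restrictScalars (i : Fin 2) (y : ℂ × ℂ × ℂ) :
    fderiv ℝ (bundleVec i) y = (fderiv ℂ (bundleVec i) y).restrictScalars ℝ :=
  ((contDiff_bundleVec i).differentiable (by simp) y).fderiv_restrictScalars ℝ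

theorem hasFDerivAt_affineVec_apply (i l : Fin 2) (y : ℂ × ℂ × ℂ) :
    HasFDerivAt (fun y : ℂ × ℂ × ℂ => affineVec i y.1 l)
      (if l = i then 0 else .fst ℝ ℂ (ℂ × ℂ) : ℂ × ℂ × ℂ →L[ℝ] ℂ) y := by
  by_cases h : l = i
  · simpa [affineVec, h] using hasFDerivAt_const (𝕜 := ℝ) (1 : ℂ) y
  · simpa [affineVec, h] using hasFDerivAt_fst

theorem wCoord_fderiv_bundleVec_castAdd (i l : Fin 2) (y X : ℂ × ℂ × ℂ) :
    wCoord (fderiv ℝ (bundleVec i) y X) (Fin.castAdd 2 l) =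
      y.2.1 * (if l = i then 0 else X.1) + affineVec i y.1 l * X.2.1 := by
  have h := (wCoordCLM (Fin.castAdd 2 l)).hasFDerivAt.comp y (hasFDerivAt_bundleVec i y)
  simp only [Function.comp_def, wCoordCLM_apply, wCoord_bundleVec_castAdd] at h
  refine (DFunLike.congr_fun (h.unique (((hasFDerivAt_fst (𝕜 := ℝ)).comp y
    hasFDerivAt_snd).mul (hasFDerivAt_affineVec_apply i l y))) X).trans ?_
  split_ifs <;> simp

theorem wCoord_fderiv_bundleVec_natAdd (i l : Fin 2) (y X : ℂ × ℂ × ℂ) :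
    wCoord (fderiv ℝ (bundleVec i) y X) (Fin.natAdd 2 l) =
      y.2.2 * (if l = i then 0 else X.1) + affineVec i y.1 l * X.2.2 := by
  have h := (wCoordCLM (Fin.natAdd 2 l)).hasFDerivAt.comp y (hasFDerivAt_bundleVec i y)
  simp only [Function.comp_def, wCoordCLM_apply, wCoord_bundleVec_natAdd] at h
  refine (DFunLike.congr_fun (h.unique (((hasFDerivAt_snd (𝕜 := ℝ)).comp y
    hasFDerivAt_snd).mul (hasFDerivAt_affineVec_apply i l y))) X).trans ?_
  split_ifs <;> simp

theorem sum_fin_four_eq (i : Fin 2) (f : Fin 4 → ℝ) : ∑ j, f j =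
    f (Fin.castAdd 2 i) + f (Fin.castAdd 2 (i + 1)) +
    (f (Fin.natAdd 2 i) + f (Fin.natAdd 2 (i + 1))) := by
  fin_cases i <;> simp [Fin.sum_univ_four] <;> ring_nf

theorem norm_mul_sq_le (a b c d : ℂ) :
    ‖b * d‖ ^ 2 ≤ (1 + ‖c‖ ^ 2) * (‖a‖ ^ 2 + ‖b * d + c * a‖ ^ 2) := by
  have h : ‖b * d‖ ≤ ‖b * d + c * a‖ + ‖c‖ * ‖a‖ := by
    simpa only [add_sub_cancel_right, norm_mul c a] using norm_sub_le (b * d + c * a) (c * a)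
  nlinarith [sq_nonneg (‖c‖ * ‖b * d + c * a‖ - ‖a‖), norm_nonneg (b * d)]

theorem norm_sq_bundleVec_mul_le (i : Fin 2) (y X : ℂ × ℂ × ℂ) :
    ‖bundleVec i y‖ ^ 2 * (‖X.1‖ ^ 2 / (1 + ‖y.1‖ ^ 2) ^ 2) ≤
      ‖fderiv ℝ (bundleVec i) y X‖ ^ 2 := by
  have hi : i + 1 ≠ i := by fin_cases i <;> simp
  have hvec := sum_norm_sq_wCoord (bundleVec i y)
  have hderiv := sum_norm_sq_wCoord (fderiv ℝ (bundleVec i) y X)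
  rw [sum_fin_four_eq i] at hvec hderiv
  simp only [wCoord_fderiv_bundleVec_castAdd, wCoord_fderiv_bundleVec_natAdd, affineVec, if_true,
    if_neg hi, mul_zero, zero_add, one_mul] at hderiv
  simp only [wCoord_bundleVec_castAdd, wCoord_bundleVec_natAdd, affineVec, if_true, mul_one,
    if_neg hi, norm_mul, mul_pow] at hvec
  have h₁ := norm_mul_sq_le X.2.1 y.2.1 y.1 X.1
  have h₂ := norm_mul_sq_le X.2.2 y.2.2 y.1 X.1
  rw [norm_mul, mul_pow] at h₁ h₂
  rw [← mul_div_assoc, div_le_iff₀ (by positivity)]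
  nlinarith

theorem eq_zero_of_fderiv_bundleVec_eq_zero {i : Fin 2} {y X : ℂ × ℂ × ℂ} (hX₁ : X.1 = 0)
    (hX : fderiv ℝ (bundleVec i) y X = 0) : X = 0 := by
  have h₁ := wCoord_fderiv_bundleVec_castAdd i i y X
  have h₂ := wCoord_fderiv_bundleVec_natAdd i i y X
  rw [hX, ← wCoordCLM_apply, map_zero] at h₁ h₂
  refine Prod.ext hX₁ (Prod.ext ?_ ?_)
  · simpa [affineVec] using h₁.symm
  · simpa [affineVec] using h₂.symm

theorem fderiv_bundleVec_injective {i : Fin 2} {y : ℂ × ℂ × ℂ} (hy : bundleVec i y ≠ 0) :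
    Function.Injective (fderiv ℝ (bundleVec i) y) := by
  refine (injective_iff_map_eq_zero _).2 fun X hX => eq_zero_of_fderiv_bundleVec_eq_zero ?_ hX
  have h := norm_sq_bundleVec_mul_le i y X
  rw [hX, norm_zero, zero_pow two_ne_zero] at h
  by_contra hX₁
  exact h.not_gt (by positivity)

theorem sum_bundleVec_mul_fderiv (i : Fin 2) (y X : ℂ × ℂ × ℂ) :
    ∑ j, bundleVec i y j * fderiv ℂ (bundleVec i) y X j = 0 := by
  have hsq : HasFDerivAt (fun y => ∑ j, bundleVec i y j ^ 2)
      (∑ j, (2 * bundleVec i y j) •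
        ((EuclideanSpace.proj j : C4 →L[ℂ] ℂ) ∘L fderiv ℂ (bundleVec i) y)) y := by
    refine HasFDerivAt.fun_sum fun j _ => ?_
    simpa using ((EuclideanSpace.proj j : C4 →L[ℂ] ℂ).hasFDerivAt.comp y
      ((contDiff_bundleVec i).differentiable (by simp) y).hasFDerivAt).pow 2
  simp only [sum_sq_bundleVec] at hsq
  have h := DFunLike.congr_fun (hsq.unique (hasFDerivAt_const 0 y)) X
  simpa [mul_assoc, ← Finset.mul_sum] using h

theorem exists_fderiv_bundleVec_eq {i : Fin 2} {y : ℂ × ℂ × ℂ} (hy : bundleVec i y ≠ 0) {Z : C4}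
    (hZ : ∑ j, bundleVec i y j * Z j = 0) : ∃ X, fderiv ℝ (bundleVec i) y X = Z := by
  let D : (ℂ × ℂ × ℂ) →ₗ[ℂ] C4 := fderiv ℂ (bundleVec i) y
  let φ : C4 →ₗ[ℂ] ℂ := ∑ j, bundleVec i y j • (EuclideanSpace.proj j : C4 →L[ℂ] ℂ).toLinearMap
  have hφ (Z : C4) : φ Z = ∑ j, bundleVec i y j * Z j := by simp [φ]
  have hinj := fderiv_bundleVec_injective hy
  rw [fderiv_bundleVec_eq_restrictScalars] at hinj ⊢
  have hle : LinearMap.range D ≤ LinearMap.ker φ := by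
    rintro _ ⟨X, rfl⟩
    rw [LinearMap.mem_ker, hφ]
    exact sum_bundleVec_mul_fderiv i y X
  have hφ0 : φ ≠ 0 := by
    refine fun h => hy ?_
    ext j
    simpa [hφ] using DFunLike.congr_fun h (EuclideanSpace.single j (1 : ℂ))
  have hrank : Module.finrank ℂ (LinearMap.range D) = Module.finrank ℂ (LinearMap.ker φ) := by
    have h := Module.Dual.finrank_ker_add_one_of_ne_zero hφ0
    rw [LinearMap.finrank_range_of_inj (show Function.Injective D from hinj)]
    simp only [Module.finrank_prod, Module.finrank_self, finrank_euclideanSpace,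
      Fintype.card_fin] at h ⊢
    omega
  have hZD : Z ∈ LinearMap.range D := by
    rw [Submodule.eq_of_le_of_finrank_eq hle hrank, LinearMap.mem_ker, hφ, hZ]
  exact hZD

/-- The differential of `π₂`, with values in `ℂ⁴`. -/
def dproj₂ (q : ResolvedConifold) : TangentSpace 𝓘(ℝ, ℂ × ℂ × ℂ) q →L[ℝ] C4 :=
  mfderiv 𝓘(ℝ, ℂ × ℂ × ℂ) 𝓘(ℝ, C4) proj₂ q

theorem dproj₂_eq_fderiv (q : ResolvedConifold) :
    dproj₂ q = fderiv ℝ (bundleVec q.proj₁.index) (chart q.proj₁.index q) := by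
  refine (if_pos ((contMDiff_proj₂ q).mdifferentiableAt (by simp))).trans ?_
  simp only [mfld_simps, fderivWithin_univ]
  rfl

theorem mfderiv_proj₁ (q : ResolvedConifold) :
    mfderiv 𝓘(ℝ, ℂ × ℂ × ℂ) 𝓘(ℝ, ℂ) proj₁ q = ContinuousLinearMap.fst ℝ ℂ (ℂ × ℂ) := by
  have key : writtenInExtChartAt 𝓘(ℝ, ℂ × ℂ × ℂ) 𝓘(ℝ, ℂ) q proj₁ = Prod.fst := by
    funext y
    change CP1.chart q.proj₁.index ((CP1.chart q.proj₁.index).symm y.1) = y.1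
    exact (CP1.chart _).right_inv (mem_univ _)
  have hd : MDifferentiableAt 𝓘(ℝ, ℂ × ℂ × ℂ) 𝓘(ℝ, ℂ) proj₁ q := by
    refine ⟨continuous_proj₁.continuousAt.continuousWithinAt, ?_⟩
    change DifferentiableWithinAt ℝ (writtenInExtChartAt 𝓘(ℝ, ℂ × ℂ × ℂ) 𝓘(ℝ, ℂ) q proj₁) _ _
    rw [key]
    exact differentiableWithinAt_fst
  refine (if_pos hd).trans ?_
  rw [key]
  simp only [mfld_simps, fderivWithin_univ]
  exact fderiv_fst

theorem dproj₂_J (q : ResolvedConifold) (X : TangentSpace 𝓘(ℝ, ℂ × ℂ × ℂ) q) :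
    dproj₂ q (J q X) = I • dproj₂ q X := by
  rw [dproj₂_eq_fderiv, fderiv_bundleVec_eq_restrictScalars]
  exact (fderiv ℂ (bundleVec q.proj₁.index) (chart q.proj₁.index q)).map_smul I X

theorem exists_dproj₂_eq {q : ResolvedConifold} (hq : q.proj₂ ≠ 0) {Z : C4}
    (hZ : ∑ j, q.proj₂ j * Z j = 0) : ∃ X, dproj₂ q X = Z := by
  rw [proj₂_eq_bundleVec_index] at hq hZ
  rw [dproj₂_eq_fderiv]
  exact exists_fderiv_bundleVec_eq hq hZ

theorem lift_apply (β : C4 → C4 [⋀^Fin 2]→L[ℝ] ℝ) (q : ResolvedConifold)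
    (X Y : TangentSpace 𝓘(ℝ, ℂ × ℂ × ℂ) q) :
    lift β q ![X, Y] = β q.proj₂ ![dproj₂ q X, dproj₂ q Y] :=
  Form.pullback_pair proj₂ β q X Y

theorem metric_self (q : ResolvedConifold) (X : ℂ × ℂ × ℂ) :
    metric q X X = ‖X.1‖ ^ 2 / (1 + ‖(chart q.proj₁.index q).1‖ ^ 2) ^ 2 +
      ‖dproj₂ q X‖ ^ 2 := by
  have h : metric q X X = (inner ℂ X.1 X.1).re / (1 + ‖(chart q.proj₁.index q).1‖ ^ 2) ^ 2 +
      (inner ℂ (dproj₂ q X) (dproj₂ q X)).re := by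
    unfold metric
    rw [mfderiv_proj₁]
    rfl
  rw [h, inner_self_eq_norm_sq_to_K, inner_self_eq_norm_sq_to_K]
  norm_cast

theorem norm_dproj₂_sq_le_metric (q : ResolvedConifold) (X : TangentSpace 𝓘(ℝ, ℂ × ℂ × ℂ) q) :
    ‖dproj₂ q X‖ ^ 2 ≤ metric q X X := by
  rw [metric_self q X]
  exact le_add_of_nonneg_left (by positivity)

theorem metric_le {δ : ℝ} (hδ : 0 < δ) {q : ResolvedConifold} (hq : δ ≤ ‖q.proj₂‖)
    (X : TangentSpace 𝓘(ℝ, ℂ × ℂ × ℂ) q) :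
    metric q X X ≤ (1 + (δ ^ 2)⁻¹) * ‖dproj₂ q X‖ ^ 2 := by
  rw [metric_self q X, add_comm, one_add_mul]
  have h := norm_sq_bundleVec_mul_le q.proj₁.index (chart q.proj₁.index q) X
  rw [← proj₂_eq_bundleVec_index, ← dproj₂_eq_fderiv] at h
  gcongr
  rw [le_inv_mul_iff₀ (by positivity)]
  exact (mul_le_mul_of_nonneg_right (by gcongr) (by positivity)).trans h

theorem metric_self_pos (q : ResolvedConifold) {X : TangentSpace 𝓘(ℝ, ℂ × ℂ × ℂ) q} (hX : X ≠ 0) :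
    0 < metric q X X := by
  change (ℂ × ℂ × ℂ) at X
  rw [metric_self]
  by_cases hX₁ : X.1 = 0
  · have h : dproj₂ q X ≠ 0 := fun h =>
      hX (eq_zero_of_fderiv_bundleVec_eq_zero hX₁ (by rwa [← dproj₂_eq_fderiv]))
    positivity
  · positivity

theorem uniformlyTameOn_lift {β : C4 → C4 [⋀^Fin 2]→L[ℝ] ℝ} {U : Set ResolvedConifold} {δ a b : ℝ}
    (hδ : 0 < δ) (hU : ∀ q ∈ U, δ ≤ ‖q.proj₂‖) (ha : 0 < a)
    (hβ : ∀ q ∈ U, ∀ Z : C4,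
      a * ‖Z‖ ^ 2 ≤ β q.proj₂ ![Z, I • Z] ∧ β q.proj₂ ![Z, I • Z] ≤ b * ‖Z‖ ^ 2) :
    (lift β).UniformlyTameOn J metric U := by
  set c := 1 + (δ ^ 2)⁻¹
  refine ⟨max 1 (max b (c / a)), le_max_left _ _, fun q hq X => ?_⟩
  set C := max 1 (max b (c / a))
  have hC : 0 < C := one_pos.trans_le (le_max_left _ _)
  have hb : b ≤ C := (le_max_left _ _).trans (le_max_right _ _)
  have hc : c ≤ C * a := (div_le_iff₀ ha).1 ((le_max_right _ _).trans (le_max_right _ _))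
  obtain ⟨hlow, hup⟩ := hβ q hq (dproj₂ q X)
  rw [lift_apply, dproj₂_J]
  constructor
  · rw [inv_mul_le_iff₀ hC]
    calc metric q X X ≤ c * ‖dproj₂ q X‖ ^ 2 := metric_le hδ (hU q hq) X
      _ ≤ C * a * ‖dproj₂ q X‖ ^ 2 := by gcongr
      _ ≤ C * β q.proj₂ ![dproj₂ q X, I • dproj₂ q X] := by rw [mul_assoc]; gcongr
  · calc β q.proj₂ ![dproj₂ q X, I • dproj₂ q X] ≤ b * ‖dproj₂ q X‖ ^ 2 := hup
      _ ≤ C * ‖dproj₂ q X‖ ^ 2 := by gcongr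
      _ ≤ C * metric q X X := by gcongr; exact norm_dproj₂_sq_le_metric q X

end ResolvedConifold

section PerturbedForm

open ResolvedConifold

variable {ξ : R4 → R4} {ε : ℝ}

theorem perturbedForm_eq_pullback_extDeriv (hξ : ContDiff ℝ ∞ ξ) (ε : ℝ) :
    perturbedForm ξ ε = Form.pullback proj₂ (extDeriv (shearPrimitive ξ ε)) := by
  rw [extDeriv_shearPrimitive hξ]
  rfl

theorem perturbedForm_smoothOn (hξ : ContDiff ℝ ∞ ξ) (ε : ℝ) (U : Set ResolvedConifold) :
    (perturbedForm ξ ε).SmoothOn U :=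
  Form.smoothOn_pullback contMDiff_proj₂ (contDiff_pushforward_shear hξ ε) U

theorem perturbedForm_exactOn (hξ : ContDiff ℝ ∞ ξ) (ε : ℝ) (U : Set ResolvedConifold) :
    (perturbedForm ξ ε).ExactOn U := by
  rw [perturbedForm_eq_pullback_extDeriv hξ]
  exact Form.exactOn_pullback_extDeriv contMDiff_proj₂ (contDiff_shearPrimitive hξ ε) U

theorem perturbedForm_d (hξ : ContDiff ℝ ∞ ξ) (ε : ℝ) (q : ResolvedConifold) :
    (perturbedForm ξ ε).d q = 0 := by
  refine (Form.d_pullback contMDiff_proj₂ (contDiff_pushforward_shear hξ ε) q).trans ?_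
  rw [← extDeriv_shearPrimitive hξ, extDeriv_extDeriv (contDiff_shearPrimitive hξ ε)
    (by rw [minSmoothness_of_isRCLikeNormedField]; exact WithTop.coe_le_coe.2 le_top)]
  rfl

theorem perturbedForm_uniformlyTameOn (hξ : Differentiable ℝ ξ) {δ : ℝ} (hδ : 0 < δ)
    {U : Set ResolvedConifold} (hU : ∀ q ∈ U, δ ≤ ‖q.proj₂‖)
    (hcurl : ∀ q ∈ U, |ε| * ‖curl ξ (rePart q.proj₂)‖ ≤ 3 / 2) :
    (perturbedForm ξ ε).UniformlyTameOn J metric U := by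
  refine uniformlyTameOn_lift (a := 1 / 4) (b := 7 / 4) hδ hU (by norm_num) fun q hq Z => ?_
  have h := abs_le.1 (abs_pushforward_shear_sub_le hξ ε q.proj₂ Z)
  have hle := mul_le_mul_of_nonneg_right (hcurl q hq) (sq_nonneg ‖Z‖)
  constructor <;> linarith

theorem perturbedForm_symplecticOn (hξ : ContDiff ℝ ∞ ξ) {U : Set ResolvedConifold}
    (h : (perturbedForm ξ ε).UniformlyTameOn J metric U) : (perturbedForm ξ ε).SymplecticOn U :=
  ⟨perturbedForm_smoothOn hξ ε U, fun q _ => perturbedForm_d hξ ε q,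
    fun q hq _ hX => h.exists_ne_zero hq (metric_self_pos q hX)⟩

end PerturbedForm

/-! ### Knots and conical coordinates -/

theorem inner_add_inner_eq_zero_of_hasDerivAt {E : Type*} [NormedAddCommGroup E]
    [InnerProductSpace ℝ E] {f g : ℝ → E} {f' g' : E} {t c : ℝ} (hf : HasDerivAt f f' t)
    (hg : HasDerivAt g g' t) (h : ∀ᶠ s in 𝓝 t, inner ℝ (f s) (g s) = c) :
    inner ℝ (f t) g' + inner ℝ f' (g t) = 0 :=
  (hf.inner ℝ hg).unique ((hasDerivAt_const t c).congr_of_eventuallyEq h)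

theorem periodic_deriv {F : Type*} [NormedAddCommGroup F] [NormedSpace ℝ F] {f : ℝ → F} {c : ℝ}
    (h : Function.Periodic f c) : Function.Periodic (deriv f) c := fun t => by
  rw [← deriv_comp_add_const, funext h]

namespace Knot

variable (k : Knot)

/-- The unit tangent vector `k'(t)`. -/
def tangent (t : ℝ) : R4 := deriv k.toFun t

/-- The acceleration `k''(t)`. -/
def accel (t : ℝ) : R4 := deriv k.tangent t

theorem contDiff_tangent : ContDiff ℝ ∞ k.tangent :=
  (contDiff_infty_iff_deriv.1 k.smooth).2

theorem contDiff_accel : ContDiff ℝ ∞ k.accel :=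
  (contDiff_infty_iff_deriv.1 k.contDiff_tangent).2

theorem hasDerivAt (t : ℝ) : HasDerivAt k.toFun (k.tangent t) t :=
  (k.smooth.differentiable (by simp) t).hasDerivAt

theorem hasDerivAt_tangent (t : ℝ) : HasDerivAt k.tangent (k.accel t) t :=
  (k.contDiff_tangent.differentiable (by simp) t).hasDerivAt

theorem periodic_tangent : Function.Periodic k.tangent k.length := periodic_deriv k.periodic

theorem periodic_accel : Function.Periodic k.accel k.length := periodic_deriv k.periodic_tangent

theorem norm_tangent (t : ℝ) : ‖k.tangent t‖ = 1 := k.unit_speed t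

theorem norm_smul_toFun {r : ℝ} (hr : 0 ≤ r) (t : ℝ) : ‖r • k.toFun t‖ = r := by
  rw [norm_smul, k.norm_eq_one, mul_one, Real.norm_of_nonneg hr]

theorem inner_self (t : ℝ) : inner ℝ (k.toFun t) (k.toFun t) = 1 := by
  rw [real_inner_self_eq_norm_sq, k.norm_eq_one, one_pow]

theorem inner_tangent_self (t : ℝ) : inner ℝ (k.tangent t) (k.tangent t) = 1 := by
  rw [real_inner_self_eq_norm_sq, k.norm_tangent, one_pow]

theorem inner_tangent (t : ℝ) : inner ℝ (k.toFun t) (k.tangent t) = 0 := by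
  have h := inner_add_inner_eq_zero_of_hasDerivAt (k.hasDerivAt t) (k.hasDerivAt t)
    (.of_forall k.inner_self)
  rw [real_inner_comm (k.toFun t)] at h
  linarith

theorem inner_tangent_toFun (t : ℝ) : inner ℝ (k.tangent t) (k.toFun t) = 0 :=
  (real_inner_comm _ _).trans (k.inner_tangent t)

theorem inner_tangent_accel (t : ℝ) : inner ℝ (k.tangent t) (k.accel t) = 0 := by
  have h := inner_add_inner_eq_zero_of_hasDerivAt (k.hasDerivAt_tangent t) (k.hasDerivAt_tangent t)
    (.of_forall k.inner_tangent_self)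
  rw [real_inner_comm (k.tangent t)] at h
  linarith

theorem inner_accel (t : ℝ) : inner ℝ (k.toFun t) (k.accel t) = -1 := by
  have h := inner_add_inner_eq_zero_of_hasDerivAt (k.hasDerivAt t) (k.hasDerivAt_tangent t)
    (.of_forall k.inner_tangent)
  rw [k.inner_tangent_self] at h
  linarith

theorem exists_int_of_eq {s t : ℝ} (h : k.toFun s = k.toFun t) :
    ∃ n : ℤ, s = t + n * k.length := by
  obtain ⟨m, hm, -⟩ := existsUnique_add_zsmul_mem_Ico k.length_pos s 0
  obtain ⟨n, hn, -⟩ := existsUnique_add_zsmul_mem_Ico k.length_pos t 0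
  rw [zero_add] at hm hn
  have heq : s + m • k.length = t + n • k.length :=
    k.injOn hm hn (by rw [k.periodic.zsmul, k.periodic.zsmul, h])
  refine ⟨n - m, ?_⟩
  rw [zsmul_eq_mul, zsmul_eq_mul] at heq
  push_cast
  linarith

theorem eventually_exists_int_add_mem (t₀ : ℝ) {s : Set ℝ} (hs : s ∈ 𝓝 t₀) :
    ∀ᶠ y in 𝓝 (k.toFun t₀), ∀ t, k.toFun t = y → ∃ n : ℤ, t + n * k.length ∈ s := by
  set I := Icc (t₀ - k.length / 2) (t₀ + k.length / 2)
  have hK : IsClosed (k.toFun '' (I \ interior s)) :=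
    ((isCompact_Icc.diff isOpen_interior).image k.smooth.continuous).isClosed
  have ht₀ : k.toFun t₀ ∉ k.toFun '' (I \ interior s) := by
    rintro ⟨t, ⟨⟨hl, hr⟩, hts⟩, ht⟩
    obtain ⟨n, rfl⟩ := k.exists_int_of_eq ht
    have hpos := k.length_pos
    have hn : n = 0 := by
      have h1 : (n : ℝ) < 1 := by nlinarith
      have h2 : (-1 : ℝ) < n := by nlinarith
      norm_cast at h1 h2
      omega
    rw [hn, Int.cast_zero, zero_mul, add_zero] at hts
    exact hts (mem_interior_iff_mem_nhds.2 hs)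
  filter_upwards [hK.isOpen_compl.mem_nhds ht₀] with y hy t hty
  obtain ⟨n, hn, -⟩ := existsUnique_add_zsmul_mem_Ico k.length_pos t (t₀ - k.length / 2)
  have hnI : t + n • k.length ∈ I := ⟨hn.1, by linarith [hn.2]⟩
  refine ⟨n, ?_⟩
  by_contra hns
  rw [← zsmul_eq_mul] at hns
  exact hy ⟨_, ⟨hnI, fun h => hns (interior_subset h)⟩, (k.periodic.zsmul n t).trans hty⟩

/-- The orthogonal complement of the plane spanned by `k(t)` and `k'(t)`, that is, the normal space
of the knot in `S³`. -/
def normalSpace (t : ℝ) : Submodule ℝ R4 :=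
  (Submodule.span ℝ {k.toFun t, k.tangent t})ᗮ

variable {k} in
theorem mem_normalSpace_iff {t : ℝ} {v : R4} :
    v ∈ k.normalSpace t ↔ inner ℝ (k.toFun t) v = 0 ∧ inner ℝ (k.tangent t) v = 0 := by
  rw [normalSpace, Submodule.mem_orthogonal]
  refine ⟨fun h => ⟨h _ (Submodule.subset_span (by simp)), h _ (Submodule.subset_span (by simp))⟩,
    fun ⟨h1, h2⟩ u hu => ?_⟩
  obtain ⟨a, b, rfl⟩ := Submodule.mem_span_pair.1 hu
  rw [inner_add_left, inner_smul_left, inner_smul_left, h1, h2, mul_zero, mul_zero, add_zero]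

/-- Conical coordinates near the ray through `k(t₀)`: the parameter of the knot, the distance along
the ray, and the displacement from the cone over the knot, taken in the normal space at `t₀`. -/
def coneParam (t₀ : ℝ) (y : ℝ × ℝ × k.normalSpace t₀) : R4 := y.2.1 • k.toFun y.1 + y.2.2

theorem contDiff_coneParam (t₀ : ℝ) : ContDiff ℝ ∞ (k.coneParam t₀) :=
  (contDiff_snd.fst.smul (k.smooth.comp contDiff_fst)).add
    ((k.normalSpace t₀).subtypeL.contDiff.comp contDiff_snd.snd)

/-- The differential at `(t₀, r, 0)` of the conical coordinates. -/
def coneFrame (t₀ r : ℝ) : ℝ × ℝ × k.normalSpace t₀ →L[ℝ] R4 :=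
  (ContinuousLinearMap.toSpanSingleton ℝ (r • k.tangent t₀)).coprod
    ((ContinuousLinearMap.toSpanSingleton ℝ (k.toFun t₀)).coprod (k.normalSpace t₀).subtypeL)

theorem coneFrame_apply (t₀ r : ℝ) (y : ℝ × ℝ × k.normalSpace t₀) :
    k.coneFrame t₀ r y = y.1 • r • k.tangent t₀ + (y.2.1 • k.toFun t₀ + y.2.2) := rfl

theorem hasFDerivAt_coneParam (t₀ r : ℝ) :
    HasFDerivAt (k.coneParam t₀) (k.coneFrame t₀ r) (t₀, r, 0) := by
  let y₀ : ℝ × ℝ × k.normalSpace t₀ := (t₀, r, 0)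
  have hfst := hasFDerivAt_fst (𝕜 := ℝ) (p := y₀)
  have hsnd := hasFDerivAt_snd (𝕜 := ℝ) (p := y₀)
  have hk := (k.hasDerivAt t₀).hasFDerivAt.comp y₀ hfst
  have hv := (k.normalSpace t₀).subtypeL.hasFDerivAt.comp y₀ hsnd.snd
  refine ((hsnd.fst.smul hk).add hv).congr_fderiv (ContinuousLinearMap.ext fun y => ?_)
  simp [y₀, coneFrame_apply, smul_comm r, add_assoc]

theorem bijective_coneFrame (t₀ : ℝ) {r : ℝ} (hr : r ≠ 0) :
    Function.Bijective (k.coneFrame t₀ r) := by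
  have hinner (y : ℝ × ℝ × k.normalSpace t₀) :
      inner ℝ (k.toFun t₀) (k.coneFrame t₀ r y) = y.2.1 ∧
        inner ℝ (k.tangent t₀) (k.coneFrame t₀ r y) = y.1 * r := by
    obtain ⟨h1, h2⟩ := mem_normalSpace_iff.1 y.2.2.2
    simp [coneFrame_apply, inner_add_right, inner_smul_right, k.norm_eq_one, k.norm_tangent,
      k.inner_tangent, k.inner_tangent_toFun, h1, h2]
  refine ⟨(injective_iff_map_eq_zero _).2 fun y hy => ?_, fun x => ?_⟩
  · obtain ⟨h1, h2⟩ := hinner y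
    rw [hy, inner_zero_right] at h1 h2
    have h3 : y.1 = 0 := by simpa [hr] using h2.symm
    rw [coneFrame_apply, h3, ← h1] at hy
    exact Prod.ext h3 (Prod.ext h1.symm (Subtype.ext (by simpa using hy)))
  · have hv : x - inner ℝ (k.tangent t₀) x • k.tangent t₀ - inner ℝ (k.toFun t₀) x • k.toFun t₀ ∈
        k.normalSpace t₀ := by
      simp [mem_normalSpace_iff, inner_sub_right, inner_smul_right, k.norm_eq_one,
        k.norm_tangent, k.inner_tangent, k.inner_tangent_toFun]
    refine ⟨(inner ℝ (k.tangent t₀) x / r, inner ℝ (k.toFun t₀) x, ⟨_, hv⟩), ?_⟩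
    rw [coneFrame_apply, smul_smul, div_mul_cancel₀ _ hr]
    dsimp only
    abel

/-- The differential of the conical coordinates away from the origin, as an equivalence. -/
def coneFrameEquiv (t₀ : ℝ) {r : ℝ} (hr : r ≠ 0) : (ℝ × ℝ × k.normalSpace t₀) ≃L[ℝ] R4 :=
  (LinearEquiv.ofBijective (k.coneFrame t₀ r).toLinearMap
    (k.bijective_coneFrame t₀ hr)).toContinuousLinearEquiv

theorem finrank_normalSpace (t : ℝ) : Module.finrank ℝ (k.normalSpace t) = 2 := by
  have h := (k.coneFrameEquiv t one_ne_zero).toLinearEquiv.finrank_eq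
  rw [Module.finrank_prod, Module.finrank_prod, Module.finrank_self, finrank_euclideanSpace,
    Fintype.card_fin] at h
  omega

/-- Smooth conical coordinates of a knot on a neighbourhood of the point `r₀ k(t₀)`. The parameter
of the knot is only recovered up to a multiple of its length. -/
structure ConeChart (t₀ r₀ : ℝ) where
  domain : Set R4
  coord : R4 → ℝ × ℝ × k.normalSpace t₀
  isOpen_domain : IsOpen domain
  base_mem : r₀ • k.toFun t₀ ∈ domain
  contDiffOn_coord : ContDiffOn ℝ ∞ coord domain
  coneParam_coord : ∀ x ∈ domain, k.coneParam t₀ (coord x) = x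
  radius_pos : ∀ x ∈ domain, 0 < (coord x).2.1
  coord_base : coord (r₀ • k.toFun t₀) = (t₀, r₀, 0)
  exists_coord_eq : ∀ t r, 0 < r → r • k.toFun t ∈ domain →
    ∃ n : ℤ, coord (r • k.toFun t) = (t + n * k.length, r, 0)
  fderiv_coord : ∀ y, fderiv ℝ coord (r₀ • k.toFun t₀) (k.coneFrame t₀ r₀ y) = y

theorem eventually_exists_int_prod_mem (t₀ : ℝ) {r₀ : ℝ} (hr₀ : 0 < r₀)
    {s : Set (ℝ × ℝ × k.normalSpace t₀)} (hs : s ∈ 𝓝 (t₀, r₀, 0)) :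
    ∀ᶠ x in 𝓝 (r₀ • k.toFun t₀), ∀ t r, 0 < r → r • k.toFun t = x →
      ∃ n : ℤ, (t + n * k.length, r, 0) ∈ s := by
  rw [nhds_prod_eq, nhds_prod_eq] at hs
  obtain ⟨A, hA, BC, hBC, hABC⟩ := Filter.mem_prod_iff.1 hs
  obtain ⟨B, hB, C, hC, hBC'⟩ := Filter.mem_prod_iff.1 hBC
  have hnorm : Filter.Tendsto norm (𝓝 (r₀ • k.toFun t₀)) (𝓝 r₀) := by
    simpa only [k.norm_smul_toFun hr₀.le] using
      (continuous_norm (E := R4)).tendsto (r₀ • k.toFun t₀)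
  have hdir : Filter.Tendsto (fun x => ‖x‖⁻¹ • x) (𝓝 (r₀ • k.toFun t₀)) (𝓝 (k.toFun t₀)) := by
    simpa only [inv_smul_smul₀ hr₀.ne', id] using (hnorm.inv₀ hr₀.ne').smul
      (Filter.tendsto_id (x := 𝓝 (r₀ • k.toFun t₀)))
  filter_upwards [hnorm hB, hdir.eventually (k.eventually_exists_int_add_mem t₀ hA)]
    with x hxB hxA t r hr hx
  have hxr : ‖x‖ = r := by rw [← hx, k.norm_smul_toFun hr.le]
  obtain ⟨n, hn⟩ := hxA t (by rw [hxr, ← hx, inv_smul_smul₀ hr.ne'])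
  rw [mem_preimage, hxr] at hxB
  exact ⟨n, hABC ⟨hn, hBC' ⟨hxB, mem_of_mem_nhds hC⟩⟩⟩

theorem nonempty_coneChart (t₀ : ℝ) {r₀ : ℝ} (hr₀ : 0 < r₀) : Nonempty (k.ConeChart t₀ r₀) := by
  obtain ⟨e, hbase, -, he, hesymm⟩ := exists_openPartialHomeomorph_of_contDiffOn isOpen_univ
    (k.contDiff_coneParam t₀).contDiffOn (mem_univ (t₀, r₀, 0))
    (h' := k.coneFrameEquiv t₀ hr₀.ne') (k.hasFDerivAt_coneParam t₀ r₀)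
  have heb : e (t₀, r₀, 0) = r₀ • k.toFun t₀ := by simp [he, coneParam]
  have hsymm : e.symm (r₀ • k.toFun t₀) = (t₀, r₀, 0) := by rw [← heb, e.left_inv hbase]
  have htarget : r₀ • k.toFun t₀ ∈ e.target := heb ▸ e.map_source hbase
  have hpos : ∀ᶠ x in 𝓝 (r₀ • k.toFun t₀), 0 < (e.symm x).2.1 :=
    (e.symm.continuousAt htarget).snd.fst.eventually_const_lt (by simpa only [hsymm] using hr₀)
  obtain ⟨D, hD, hDo, hbD⟩ := eventually_nhds_iff.1 ((e.open_target.eventually_mem htarget).and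
    (hpos.and (k.eventually_exists_int_prod_mem t₀ hr₀ (e.open_source.mem_nhds hbase))))
  have hfderiv : HasFDerivAt e.symm ((k.coneFrameEquiv t₀ hr₀.ne').symm : R4 →L[ℝ] _)
      (r₀ • k.toFun t₀) :=
    e.hasFDerivAt_symm htarget (by rw [hsymm, he]; exact k.hasFDerivAt_coneParam t₀ r₀)
  refine ⟨⟨D, e.symm, hDo, hbD, hesymm.mono fun x hx => (hD x hx).1, fun x hx => ?_,
    fun x hx => (hD x hx).2.1, hsymm, fun t r hr hx => ?_, fun y => ?_⟩⟩
  · rw [← he, e.right_inv (hD x hx).1]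
  · obtain ⟨n, hn⟩ := (hD _ hx).2.2 t r hr rfl
    refine ⟨n, ?_⟩
    rw [← e.left_inv hn, he, coneParam, k.periodic.int_mul n t, Submodule.coe_zero, add_zero]
  · rw [hfderiv.fderiv]
    exact (k.coneFrameEquiv t₀ hr₀.ne').symm_apply_apply y

end Knot

open InnerProductSpace

/-! ### Vector fields that are homogeneous away from the origin -/

theorem exists_contDiff_eq_comp_normalize {E F : Type*} [NormedAddCommGroup E]
    [InnerProductSpace ℝ E] [NormedAddCommGroup F] [NormedSpace ℝ F] {η : E → F}
    (hη : ContDiff ℝ ∞ η) {R : ℝ} (hR : 0 < R) :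
    ∃ ξ : E → F, ContDiff ℝ ∞ ξ ∧ ∀ x, R ≤ ‖x‖ → ξ x = η (NormedSpace.normalize x) := by
  let χ : ContDiffBump (0 : E) := ⟨R / 2, R, half_pos hR, half_lt_self hR⟩
  refine ⟨fun x => (1 - χ x) • η (NormedSpace.normalize x), ?_, fun x hx => ?_⟩
  · refine contDiff_iff_contDiffAt.2 fun x => ?_
    by_cases hx : x = 0
    · rw [hx]
      refine (contDiffAt_const (c := 0)).congr_of_eventuallyEq ?_
      filter_upwards [χ.eventuallyEq_one] with y hy
      simp [hy]
    · exact (contDiffAt_const.sub χ.contDiffAt).smul (hη.contDiffAt.comp x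
        (((contDiffAt_norm ℝ hx).inv (norm_ne_zero_iff.2 hx)).smul contDiffAt_id))
  · simp [χ.zero_of_le_dist (x := x) (by rwa [dist_zero_right])]

theorem exists_bound_fderiv_of_homogeneous {E F : Type*} [NormedAddCommGroup E] [NormedSpace ℝ E]
    [FiniteDimensional ℝ E] [NormedAddCommGroup F] [NormedSpace ℝ F] {ξ : E → F}
    (hξ : ContDiff ℝ 1 ξ) {R : ℝ} (hR : 0 < R)
    (hom : ∀ (x : E) (c : ℝ), R ≤ ‖x‖ → 1 ≤ c → ξ (c • x) = ξ x) :
    ∃ B, ∀ x, ‖fderiv ℝ ξ x‖ ≤ B := by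
  obtain ⟨B, hB⟩ := (isCompact_closedBall (0 : E) (2 * R)).exists_bound_of_continuousOn
    (hξ.continuous_fderiv one_ne_zero).continuousOn
  have hscale {c : ℝ} (hc : 1 ≤ c) {y : E} (hy : R < ‖y‖) :
      fderiv ℝ ξ y = c • fderiv ℝ ξ (c • y) := by
    rw [← fderiv_comp_smul]
    refine Filter.EventuallyEq.fderiv_eq ?_
    filter_upwards [continuous_norm.continuousAt.eventually_const_lt hy] with w hw
    exact (hom w c hw.le hc).symm
  refine ⟨B, fun x => ?_⟩
  rcases le_or_gt ‖x‖ (2 * R) with hx | hx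
  · exact hB x (mem_closedBall_zero_iff.2 hx)
  have hc : 1 ≤ ‖x‖ / (2 * R) := (one_le_div (by positivity)).2 hx.le
  have hc0 : 0 < ‖x‖ / (2 * R) := one_pos.trans_le hc
  set c := ‖x‖ / (2 * R) with hcdef
  have hy : ‖c⁻¹ • x‖ = 2 * R := by
    rw [norm_smul, norm_inv, Real.norm_of_nonneg hc0.le, hcdef, inv_div,
      div_mul_cancel₀ _ (by linarith)]
  have hfderiv := hscale hc (y := c⁻¹ • x) (by linarith)
  rw [smul_inv_smul₀ hc0.ne'] at hfderiv
  calc ‖fderiv ℝ ξ x‖ ≤ c * ‖fderiv ℝ ξ x‖ := le_mul_of_one_le_left (norm_nonneg _) hc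
    _ = ‖fderiv ℝ ξ (c⁻¹ • x)‖ := by rw [hfderiv, norm_smul, Real.norm_of_nonneg hc0.le]
    _ ≤ B := hB _ (mem_closedBall_zero_iff.2 hy.le)

theorem hasFDerivAt_comp_normalize {E F : Type*} [NormedAddCommGroup E] [InnerProductSpace ℝ E]
    [NormedAddCommGroup F] [NormedSpace ℝ F] {η : E → F} {A : E →L[ℝ] F} {u : E} (hu : ‖u‖ = 1)
    (hη : HasFDerivAt η A u) (hA : A u = 0) {r : ℝ} (hr : 0 < r) :
    HasFDerivAt (fun x => η (NormedSpace.normalize x)) (r⁻¹ • A) (r • u) := by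
  have hnorm : ‖r • u‖ = r := by rw [norm_smul, hu, mul_one, Real.norm_of_nonneg hr.le]
  have hru : r • u ≠ 0 := norm_pos_iff.1 (by rwa [hnorm])
  have hinv : HasFDerivAt (fun x : E => ‖x‖⁻¹) (fderiv ℝ (fun x => ‖x‖⁻¹) (r • u)) (r • u) :=
    (((contDiffAt_norm ℝ hru (n := 1)).inv (norm_ne_zero_iff.2 hru)).differentiableAt
      one_ne_zero).hasFDerivAt
  have hη' : HasFDerivAt η A (NormedSpace.normalize (r • u)) := by
    rwa [NormedSpace.normalize_smul_of_pos (x := u) hr,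
      NormedSpace.normalize_eq_self_of_norm_eq_one hu]
  refine (hη'.comp _ (hinv.smul (hasFDerivAt_id (r • u)))).congr_fderiv ?_
  ext v
  simp [hnorm, hA]

theorem norm_rankOne_sub_rankOne_le {E : Type*} [NormedAddCommGroup E] [InnerProductSpace ℝ E]
    {u v : E} (hu : ‖u‖ = 1) (hv : ‖v‖ = 1) (huv : inner ℝ u v = 0) :
    ‖rankOne ℝ u v - rankOne ℝ v u‖ ≤ 1 := by
  have hvu : inner ℝ v u = 0 := (real_inner_comm _ _).trans huv
  refine ContinuousLinearMap.opNorm_le_bound _ zero_le_one fun x => ?_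
  have hrot : ‖inner ℝ v x • u - inner ℝ u x • v‖ ^ 2 = inner ℝ u x ^ 2 + inner ℝ v x ^ 2 := by
    rw [norm_sub_sq_real, norm_smul, norm_smul, inner_smul_left, inner_smul_right, huv, hu, hv]
    simp
    ring
  have hbessel : ‖x - (inner ℝ u x • u + inner ℝ v x • v)‖ ^ 2 =
      ‖x‖ ^ 2 - (inner ℝ u x ^ 2 + inner ℝ v x ^ 2) := by
    simp only [← real_inner_self_eq_norm_sq, inner_sub_left, inner_sub_right, inner_add_left,
      inner_add_right, inner_smul_left, inner_smul_right, huv, hvu, real_inner_comm x]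
    simp [hu, hv]
    ring
  rw [one_mul]
  refine le_of_sq_le_sq ?_ (norm_nonneg x)
  change ‖inner ℝ v x • u - inner ℝ u x • v‖ ^ 2 ≤ _
  linarith [sq_nonneg ‖x - (inner ℝ u x • u + inner ℝ v x • v)‖]

namespace Knot

variable (k : Knot)

theorem exists_jet_extension {F : Type*} [NormedAddCommGroup F] [NormedSpace ℝ F]
    {a a' : ℝ → F} {b : ℝ → R4 →L[ℝ] F} (ha : ContDiff ℝ ∞ a) (hb : ContDiff ℝ ∞ b)
    (ha' : ∀ t, HasDerivAt a (a' t) t)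
    (hap : Function.Periodic a k.length) (hbp : Function.Periodic b k.length)
    (hab : ∀ t, b t (k.tangent t) = a' t) :
    ∃ g : R4 → F, ContDiff ℝ ∞ g ∧ ∀ t, g (k.toFun t) = a t ∧ HasFDerivAt g (b t) (k.toFun t) := by
  refine exists_contDiff_of_local_jets k.toFun a b fun x => ?_
  by_cases hx : x ∈ range k.toFun
  · obtain ⟨t₀, rfl⟩ := hx
    obtain ⟨c⟩ := k.nonempty_coneChart t₀ one_pos
    let τ : R4 → ℝ := fun x => (c.coord x).1
    have hτ : ContDiffOn ℝ ∞ τ c.domain := contDiff_fst.comp_contDiffOn c.contDiffOn_coord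
    refine ⟨c.domain, c.isOpen_domain, by simpa using c.base_mem,
      fun x => a (τ x) + b (τ x) (x - k.toFun (τ x)), ?_, fun t ht => ?_⟩
    · exact (ha.comp_contDiffOn hτ).add ((hb.comp_contDiffOn hτ).clm_apply
        (contDiffOn_id.sub (k.smooth.comp_contDiffOn hτ)))
    obtain ⟨n, hn⟩ := c.exists_coord_eq t 1 one_pos (by rwa [one_smul])
    rw [one_smul] at hn
    have hτt : τ (k.toFun t) = t + n * k.length := congrArg Prod.fst hn
    have haτ : a (τ (k.toFun t)) = a t := by rw [hτt, hap.int_mul]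
    have hbτ : b (τ (k.toFun t)) = b t := by rw [hτt, hbp.int_mul]
    have hkτ : k.toFun (τ (k.toFun t)) = k.toFun t := by rw [hτt, k.periodic.int_mul]
    have hkτ' : k.tangent (τ (k.toFun t)) = k.tangent t := by rw [hτt, k.periodic_tangent.int_mul]
    refine ⟨by simp only [haτ, hkτ, sub_self, map_zero, add_zero], ?_⟩
    have dτ : HasFDerivAt τ (fderiv ℝ τ (k.toFun t)) (k.toFun t) :=
      ((hτ.contDiffAt (c.isOpen_domain.mem_nhds ht)).differentiableAt (by simp)).hasFDerivAt
    have da := (ha' (τ (k.toFun t))).hasFDerivAt.comp (k.toFun t) dτ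
    have db := (hb.differentiable (by simp) (τ (k.toFun t))).hasFDerivAt.comp (k.toFun t) dτ
    have dk := (k.hasDerivAt (τ (k.toFun t))).hasFDerivAt.comp (k.toFun t) dτ
    refine (da.add (db.clm_apply ((hasFDerivAt_id _).sub dk))).congr_fderiv ?_
    ext v : 1
    simp [← hab, hbτ, hkτ', hkτ]
  · refine ⟨(range k.toFun)ᶜ, ?_, hx, 0, contDiff_const.contDiffOn,
      fun t ht => absurd (mem_range_self t) ht⟩
    rw [← k.periodic.image_Icc k.length_pos 0]
    exact (isCompact_Icc.image k.smooth.continuous).isClosed.isOpen_compl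

/-- The prescribed derivative at `k(t)` of a vector field which is homogeneous of degree zero and
equals `k'` along the knot. These conditions fix its values on `k(t)` and `k'(t)`; it is extended so
as to be symmetric up to a rotation in the plane spanned by `k(t)` and `k'(t)`. -/
def tangentJet (t : ℝ) : R4 →L[ℝ] R4 :=
  rankOne ℝ (k.accel t) (k.tangent t) + rankOne ℝ (k.tangent t) (k.accel t) +
    rankOne ℝ (k.tangent t) (k.toFun t)

theorem tangentJet_apply (t : ℝ) (v : R4) : k.tangentJet t v =
    inner ℝ (k.tangent t) v • k.accel t + inner ℝ (k.accel t) v • k.tangent t +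
      inner ℝ (k.toFun t) v • k.tangent t := rfl

theorem contDiff_tangentJet : ContDiff ℝ ∞ k.tangentJet := by
  have h {f g : ℝ → R4} (hf : ContDiff ℝ ∞ f) (hg : ContDiff ℝ ∞ g) :
      ContDiff ℝ ∞ fun t => rankOne ℝ (f t) (g t) :=
    ((innerSL ℝ (E := R4)).contDiff.comp hg).smulRight hf
  exact ((h k.contDiff_accel k.contDiff_tangent).add (h k.contDiff_tangent k.contDiff_accel)).add
    (h k.contDiff_tangent k.smooth)

theorem periodic_tangentJet : Function.Periodic k.tangentJet k.length := fun t => by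
  rw [tangentJet, k.periodic, k.periodic_tangent, k.periodic_accel, tangentJet]

theorem tangentJet_tangent (t : ℝ) : k.tangentJet t (k.tangent t) = k.accel t := by
  rw [tangentJet_apply, k.inner_tangent_self, real_inner_comm, k.inner_tangent_accel,
    k.inner_tangent, one_smul, zero_smul, add_zero, add_zero]

theorem tangentJet_toFun (t : ℝ) : k.tangentJet t (k.toFun t) = 0 := by
  rw [tangentJet_apply, k.inner_self, k.inner_tangent_toFun, real_inner_comm, k.inner_accel]
  module

theorem norm_tangentJet_sub_adjoint_le (t : ℝ) :
    ‖k.tangentJet t - (k.tangentJet t).adjoint‖ ≤ 1 := by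
  have h : k.tangentJet t - (k.tangentJet t).adjoint =
      rankOne ℝ (k.tangent t) (k.toFun t) - rankOne ℝ (k.toFun t) (k.tangent t) := by
    simp only [tangentJet, map_add, adjoint_rankOne]
    abel
  rw [h]
  exact norm_rankOne_sub_rankOne_le (k.norm_tangent t) (k.norm_eq_one t) (k.inner_tangent_toFun t)

theorem exists_vectorField {ε : ℝ} (hε : 0 < ε) : ∃ ξ : R4 → R4,
    ContDiff ℝ ∞ ξ ∧ (∃ B : ℝ, ∀ x, ‖fderiv ℝ ξ x‖ ≤ B) ∧
    (∀ t r, ε ≤ r → ξ (r • k.toFun t) = k.tangent t) ∧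
    ∀ t r, ε ≤ r → ‖curl ξ (r • k.toFun t)‖ ≤ r⁻¹ := by
  obtain ⟨η, hη, hηk⟩ := k.exists_jet_extension k.contDiff_tangent k.contDiff_tangentJet
    k.hasDerivAt_tangent k.periodic_tangent k.periodic_tangentJet k.tangentJet_tangent
  obtain ⟨ξ, hξ, hξη⟩ := exists_contDiff_eq_comp_normalize hη (half_pos hε)
  refine ⟨ξ, hξ, exists_bound_fderiv_of_homogeneous (hξ.of_le (by simp)) (half_pos hε) ?_, ?_, ?_⟩
  · intro x c hx hc
    have hcx : ε / 2 ≤ ‖c • x‖ := by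
      rw [norm_smul, Real.norm_of_nonneg (by linarith)]
      exact hx.trans (le_mul_of_one_le_left (norm_nonneg x) hc)
    rw [hξη _ hcx, hξη x hx, NormedSpace.normalize_smul_of_pos (by linarith)]
  · intro t r hr
    have hr0 : 0 < r := hε.trans_le hr
    rw [hξη _ (by rw [k.norm_smul_toFun hr0.le]; linarith), NormedSpace.normalize_smul_of_pos hr0,
      NormedSpace.normalize_eq_self_of_norm_eq_one (k.norm_eq_one t), (hηk t).1]
  · intro t r hr
    have hr0 : 0 < r := hε.trans_le hr
    have hnear : ∀ᶠ x in 𝓝 (r • k.toFun t), ε / 2 < ‖x‖ :=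
      continuous_norm.continuousAt.eventually_const_lt
        (by simpa only [k.norm_smul_toFun hr0.le] using (half_lt_self hε).trans_le hr)
    have hd : HasFDerivAt ξ (r⁻¹ • k.tangentJet t) (r • k.toFun t) :=
      (hasFDerivAt_comp_normalize (k.norm_eq_one t) (hηk t).2 (k.tangentJet_toFun t)
        hr0).congr_of_eventuallyEq (hnear.mono fun x hx => hξη x hx.le)
    have hcurl : curl ξ (r • k.toFun t) = r⁻¹ • (k.tangentJet t - (k.tangentJet t).adjoint) := by
      rw [curl, hd.fderiv, map_smulₛₗ, conj_trivial, smul_sub]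
    rw [hcurl, norm_smul, Real.norm_of_nonneg (by positivity)]
    exact mul_le_of_le_one_right (by positivity) (k.norm_tangentJet_sub_adjoint_le t)

end Knot

/-! ### The conifold transition of the perturbed conormal bundle -/

theorem isClosed_iUnion_of_periodic {X : Type*} [TopologicalSpace X] {S : ℝ → Set X} {c : ℝ}
    (hc : 0 < c) (hS : Function.Periodic S c) (hclosed : IsClosed {y : ℝ × X | y.2 ∈ S y.1}) :
    IsClosed (⋃ t, S t) := by
  have hIcc : ⋃ t, S t = Prod.snd '' {y : Icc (0 : ℝ) c × X | y.2 ∈ S y.1} := by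
    ext x
    simp only [mem_iUnion, mem_image, mem_ofPred_eq, Prod.exists, exists_eq_right]
    refine ⟨fun ⟨t, ht⟩ => ?_, fun ⟨t, ht⟩ => ⟨t, ht⟩⟩
    obtain ⟨s, hs, hts⟩ := hS.exists_mem_Ico₀ hc t
    exact ⟨⟨s, Ico_subset_Icc_self hs⟩, hts ▸ ht⟩
  rw [hIcc]
  exact isClosedMap_snd_of_compactSpace _
    (hclosed.preimage (f := fun y : Icc (0 : ℝ) c × X => ((y.1 : ℝ), y.2)) (by fun_prop))

namespace Knot

variable (k : Knot)

/-- The image under `F` of the fibre of `N*_{k,ε}` over `k(t)`. -/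
def contractedFiber (ε t : ℝ) : Set C4 :=
  {z | rePart z = ‖imPart z‖ • k.toFun t ∧ inner ℝ (k.toFun t) (imPart z) = 0 ∧
    inner ℝ (k.tangent t) (imPart z) = ε}

/-- The cone over the conormal bundle of the knot, without its vertices. -/
def conormalCone : Set C4 :=
  {z | ∃ t r : ℝ, 0 < r ∧ rePart z = r • k.toFun t ∧ inner ℝ (k.toFun t) (imPart z) = 0 ∧
    inner ℝ (k.tangent t) (imPart z) = 0}

theorem isClosed_iUnion_contractedFiber (ε : ℝ) : IsClosed (⋃ t, k.contractedFiber ε t) := by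
  have hk := k.smooth.continuous
  have hk' := k.contDiff_tangent.continuous
  have hre := continuous_rePart
  have him := continuous_imPart
  refine isClosed_iUnion_of_periodic k.length_pos (fun t => ?_) ?_
  · simp only [contractedFiber, k.periodic t, k.periodic_tangent t]
  · exact (isClosed_eq (by fun_prop) (by fun_prop)).inter
      ((isClosed_eq (by fun_prop) (by fun_prop)).inter (isClosed_eq (by fun_prop) (by fun_prop)))

theorem contraction_image_perturbedConormal (ε : ℝ) :
    contraction '' perturbedConormal k ε = ⋃ t, k.contractedFiber ε t := by
  ext z
  rw [mem_iUnion]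
  constructor
  · rintro ⟨_, ⟨t, p, hp, hp', rfl⟩, rfl⟩
    rw [← tangent] at hp' ⊢
    refine ⟨t, ?_⟩
    simp [contractedFiber, contraction, inner_add_right, inner_smul_right, real_inner_comm p, hp,
      hp', k.inner_tangent, k.norm_tangent]
  · rintro ⟨t, hre, hk, hk'⟩
    refine ⟨(k.toFun t, imPart z), ⟨t, imPart z - ε • k.tangent t, ?_, ?_, ?_⟩, ?_⟩
    · simp [real_inner_comm (k.toFun t), inner_sub_right, inner_smul_right, hk, k.inner_tangent]
    · rw [← tangent]
      simp [real_inner_comm (k.tangent t), inner_sub_right, inner_smul_right, hk', k.norm_tangent]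
    · rw [← tangent, sub_add_cancel]
    · rw [contraction, ← hre, ofXP_rePart_imPart]

variable {k} {ε t : ℝ} {z : C4}

theorem le_norm_imPart_of_mem_contractedFiber (hz : z ∈ k.contractedFiber ε t) :
    ε ≤ ‖imPart z‖ := by
  have h := real_inner_le_norm (k.tangent t) (imPart z)
  rwa [hz.2.2, k.norm_tangent, one_mul] at h

theorem conifoldTransition_perturbedConormal (hε : 0 < ε) :
    conifoldTransition (perturbedConormal k ε) =
      ResolvedConifold.proj₂ ⁻¹' ⋃ t, k.contractedFiber ε t := by
  have h0 : (0 : C4) ∉ ⋃ t, k.contractedFiber ε t := fun h => by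
    obtain ⟨t, ht⟩ := mem_iUnion.1 h
    have hle := le_norm_imPart_of_mem_contractedFiber ht
    rw [← imPartCLM_apply, map_zero, norm_zero] at hle
    exact hε.not_ge hle
  rw [conifoldTransition, contraction_image_perturbedConormal, sdiff_singleton_eq_self h0]
  exact ((k.isClosed_iUnion_contractedFiber ε).preimage
    ResolvedConifold.continuous_proj₂).closure_eq

theorem shear_symm_mem_conormalCone {ξ : R4 → R4} (hε : 0 < ε)
    (hξ : ∀ t r, ε ≤ r → ξ (r • k.toFun t) = k.tangent t) (hz : z ∈ k.contractedFiber ε t) :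
    (shear ξ ε).symm z ∈ k.conormalCone := by
  have hle := le_norm_imPart_of_mem_contractedFiber hz
  obtain ⟨hre, hk, hk'⟩ := hz
  refine ⟨t, ‖imPart z‖, hε.trans_le hle, ?_⟩
  simp [shear, hre, hξ t _ hle, inner_sub_right, inner_smul_right, hk, hk', k.inner_tangent,
    k.norm_tangent]

namespace ConeChart

variable {t₀ r₀ : ℝ} (c : k.ConeChart t₀ r₀)

/-- The local equation of the contracted perturbed conormal bundle inside the conifold: `Re z` lies
on the cone over the knot, and `⟨k'(t), Im z⟩ = ε` at the parameter `t` of `Re z`. -/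
def localEquation (ε : ℝ) (z : C4) : k.normalSpace t₀ × ℝ :=
  ((c.coord (rePart z)).2.2, inner ℝ (k.tangent (c.coord (rePart z)).1) (imPart z) - ε)

theorem contDiffOn_localEquation (ε : ℝ) :
    ContDiffOn ℝ ∞ (c.localEquation ε) (rePart ⁻¹' c.domain) := by
  have hcoord : ContDiffOn ℝ ∞ (fun z => c.coord (rePart z)) (rePart ⁻¹' c.domain) :=
    c.contDiffOn_coord.comp rePartCLM.contDiff.contDiffOn fun _ hz => hz
  exact hcoord.snd.snd.prodMk (((k.contDiff_tangent.comp_contDiffOn hcoord.fst).inner ℝ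
    imPartCLM.contDiff.contDiffOn).sub contDiffOn_const)

theorem localEquation_eq_zero_iff (hε : 0 < ε) (hz : ∑ j, z j ^ 2 = 0)
    (hzc : rePart z ∈ c.domain) :
    z ∈ ⋃ t, k.contractedFiber ε t ↔ c.localEquation ε z = 0 := by
  rw [mem_iUnion, localEquation, Prod.mk_eq_zero, sub_eq_zero]
  constructor
  · rintro ⟨t, ht⟩
    have hpos := hε.trans_le (le_norm_imPart_of_mem_contractedFiber ht)
    obtain ⟨n, hn⟩ := c.exists_coord_eq t _ hpos (ht.1 ▸ hzc)
    rw [ht.1, hn]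
    exact ⟨rfl, by rw [k.periodic_tangent.int_mul, ht.2.2]⟩
  · rintro ⟨hnormal, htangent⟩
    have hr := c.radius_pos _ hzc
    have hre : rePart z = (c.coord (rePart z)).2.1 • k.toFun (c.coord (rePart z)).1 := by
      conv_lhs => rw [← c.coneParam_coord _ hzc, coneParam, hnormal, Submodule.coe_zero, add_zero]
    have him : ‖imPart z‖ = (c.coord (rePart z)).2.1 := by
      rw [← norm_rePart_eq_of_sum_sq_eq_zero hz]
      conv_lhs => rw [hre, k.norm_smul_toFun hr.le]
    refine ⟨(c.coord (rePart z)).1, him ▸ hre, ?_, htangent⟩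
    have horth := inner_rePart_imPart_of_sum_sq_eq_zero hz
    rw [hre, real_inner_smul_left] at horth
    exact (mul_eq_zero.1 horth).resolve_left hr.ne'

theorem hasFDerivAt_coord_rePart (hz : rePart z = r₀ • k.toFun t₀) :
    HasFDerivAt (fun z => c.coord (rePart z))
      (fderiv ℝ c.coord (r₀ • k.toFun t₀) ∘L rePartCLM) z := by
  have hcoord : HasFDerivAt c.coord (fderiv ℝ c.coord (r₀ • k.toFun t₀)) (rePartCLM z) := by
    rw [rePartCLM_apply, hz]
    exact ((c.contDiffOn_coord.contDiffAt (c.isOpen_domain.mem_nhds c.base_mem)).differentiableAt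
      (by simp)).hasFDerivAt
  exact hcoord.comp z rePartCLM.hasFDerivAt

theorem fderiv_localEquation_apply (hz : rePart z = r₀ • k.toFun t₀)
    (y : ℝ × ℝ × k.normalSpace t₀) (w : R4) :
    fderiv ℝ (c.localEquation ε) z (ofXP (k.coneFrame t₀ r₀ y) w) =
      (y.2.2, inner ℝ (k.tangent t₀) w + y.1 * inner ℝ (k.accel t₀) (imPart z)) := by
  have hcoord := c.hasFDerivAt_coord_rePart hz
  have htangent := (k.hasDerivAt_tangent (c.coord (rePart z)).1).hasFDerivAt.comp z hcoord.fst
  have h : HasFDerivAt (c.localEquation ε) _ z :=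
    hcoord.snd.snd.prodMk ((htangent.inner ℝ imPartCLM.hasFDerivAt).sub_const ε)
  rw [h.fderiv]
  simp [c.fderiv_coord, hz, c.coord_base, real_inner_smul_left]

theorem exists_fderiv_localEquation_eq (hr : 0 < r₀) (hz : rePart z = r₀ • k.toFun t₀)
    (hzt : z ∈ k.contractedFiber ε t₀) (y : k.normalSpace t₀ × ℝ) :
    ∃ Z, ∑ j, z j * Z j = 0 ∧ fderiv ℝ (c.localEquation ε) z Z = y := by
  obtain ⟨v, b⟩ := y
  have hv := (mem_normalSpace_iff.1 v.2).1
  -- The radial part of `Re Z` and the `k`-part of `Im Z` do not affect the local equation; they are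
  -- chosen so that `Z` is tangent to the conifold.
  refine ⟨ofXP (k.coneFrame t₀ r₀ (0, b * ε / r₀, v))
    (b • k.tangent t₀ - (inner ℝ (imPart z) (v : R4) / r₀) • k.toFun t₀), ?_, ?_⟩
  · have hk : inner ℝ (imPart z) (k.toFun t₀) = 0 := by rw [real_inner_comm, hzt.2.1]
    have hk' : inner ℝ (imPart z) (k.tangent t₀) = ε := by rw [real_inner_comm, hzt.2.2]
    rw [sum_mul_ofXP, hz, coneFrame_apply]
    simp [inner_add_right, inner_sub_right, inner_smul_right, real_inner_smul_left, hk, hk', hv,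
      k.norm_eq_one, k.inner_tangent]
    field_simp
    simp [hr.ne']
  · rw [c.fderiv_localEquation_apply hz]
    simp [inner_sub_right, inner_smul_right, k.norm_tangent, k.inner_tangent_toFun]

end ConeChart

end Knot

namespace Knot

variable {k : Knot} {ε t : ℝ} {z : C4} {t₀ r₀ : ℝ}

open ResolvedConifold in
theorem ConeChart.surjective_mfderiv_localEquation (c : k.ConeChart t₀ r₀) (hε : 0 < ε)
    (hr : 0 < r₀) {q : ResolvedConifold} (hq : rePart q.proj₂ = r₀ • k.toFun t₀)
    (hqt : q.proj₂ ∈ k.contractedFiber ε t₀) :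
    Function.Surjective
      (mfderiv 𝓘(ℝ, ℂ × ℂ × ℂ) 𝓘(ℝ, k.normalSpace t₀ × ℝ) (c.localEquation ε ∘ proj₂) q) := by
  have hq₀ : q.proj₂ ≠ 0 := fun h => by
    have hle := (le_norm_imPart_of_mem_contractedFiber hqt).trans (norm_imPart_le _)
    rw [h, norm_zero] at hle
    exact hε.not_ge hle
  have hdiff : DifferentiableAt ℝ (c.localEquation ε) q.proj₂ :=
    ((c.contDiffOn_localEquation ε).contDiffAt ((c.isOpen_domain.preimage
      continuous_rePart).mem_nhds (by rw [mem_preimage, hq]; exact c.base_mem))).differentiableAt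
        (by simp)
  intro y
  obtain ⟨Z, hZ, rfl⟩ := c.exists_fderiv_localEquation_eq hr hq hqt y
  obtain ⟨X, rfl⟩ := exists_dproj₂_eq hq₀ hZ
  refine ⟨X, ?_⟩
  rw [mfderiv_comp q hdiff.mdifferentiableAt ((contMDiff_proj₂ q).mdifferentiableAt (by simp)),
    mfderiv_eq_fderiv]
  rfl

theorem isEmbeddedSubmanifold_conifoldTransition (hε : 0 < ε) :
    IsEmbeddedSubmanifold (ℂ × ℂ × ℂ) 3 (conifoldTransition (perturbedConormal k ε)) := by
  rw [conifoldTransition_perturbedConormal hε]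
  intro q hq
  obtain ⟨t, ht⟩ := mem_iUnion.1 hq
  have hr := hε.trans_le (le_norm_imPart_of_mem_contractedFiber ht)
  obtain ⟨c⟩ := k.nonempty_coneChart t hr
  have hcont : Continuous fun q : ResolvedConifold => rePart q.proj₂ :=
    continuous_rePart.comp ResolvedConifold.continuous_proj₂
  obtain ⟨e, he, hqe, V, hV, hslice⟩ := exists_slice_chart_of_regular_equation
    (c.isOpen_domain.preimage hcont) (by rw [mem_preimage, ht.1]; exact c.base_mem)
    ((c.contDiffOn_localEquation ε).contMDiffOn.comp
      ResolvedConifold.contMDiff_proj₂.contMDiffOn fun _ hx => hx)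
    (c.surjective_mfderiv_localEquation hε hr ht.1 ht)
    fun x hx => c.localEquation_eq_zero_iff hε (ResolvedConifold.sum_sq_proj₂ x) hx
  refine ⟨e, he, hqe, V, ?_, hslice⟩
  rw [Module.finrank_prod, k.finrank_normalSpace, Module.finrank_self, Module.finrank_prod,
    Module.finrank_prod, Complex.finrank_real_complex] at hV
  omega

theorem velocity_eq_of_eventually_mem_conormalCone {w : ℝ → C4} {W : C4} (hw : HasDerivAt w W 0)
    (hcone : ∀ᶠ s in 𝓝 0, w s ∈ k.conormalCone) (hr : 0 < r₀)
    (hre : rePart (w 0) = r₀ • k.toFun t₀) :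
    ∃ a b : ℝ, rePart W = a • k.toFun t₀ + (b * r₀) • k.tangent t₀ ∧
      inner ℝ (k.toFun t₀) (imPart W) = 0 ∧
      inner ℝ (k.tangent t₀) (imPart W) = -b * inner ℝ (k.accel t₀) (imPart (w 0)) := by
  obtain ⟨c⟩ := k.nonempty_coneChart t₀ hr
  obtain ⟨⟨b, a, v⟩, hy⟩ := (k.bijective_coneFrame t₀ hr.ne').2 (rePart W)
  have hcoord : HasDerivAt (fun s => c.coord (rePart (w s))) (b, a, v) 0 := by
    have h := (c.hasFDerivAt_coord_rePart hre).comp_hasDerivAt 0 hw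
    rwa [ContinuousLinearMap.comp_apply, rePartCLM_apply, ← hy, c.fderiv_coord] at h
  have hbase : c.coord (rePart (w 0)) = (t₀, r₀, 0) := by rw [hre, c.coord_base]
  have hIm : HasDerivAt (fun s => imPart (w s)) (imPart W) 0 :=
    imPartCLM.hasFDerivAt.comp_hasDerivAt 0 hw
  have heq : ∀ᶠ s in 𝓝 0, (c.coord (rePart (w s))).2.2 = 0 ∧
      inner ℝ (k.toFun (c.coord (rePart (w s))).1) (imPart (w s)) = 0 ∧
      inner ℝ (k.tangent (c.coord (rePart (w s))).1) (imPart (w s)) = 0 := by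
    have hdomain := (rePartCLM.hasFDerivAt.comp_hasDerivAt 0 hw).continuousAt.eventually_mem
      (c.isOpen_domain.mem_nhds (by simpa [hre] using c.base_mem))
    filter_upwards [hcone, hdomain] with s ⟨t, r, hr, hs, hk, hk'⟩ hsc
    obtain ⟨n, hn⟩ := c.exists_coord_eq t r hr (hs ▸ hsc)
    rw [hs, hn, k.periodic.int_mul, k.periodic_tangent.int_mul]
    exact ⟨rfl, hk, hk'⟩
  have hv : v = 0 := by
    simpa using (HasFDerivAt.hasDerivAt hcoord.snd.snd).unique
      ((hasDerivAt_const 0 0).congr_of_eventuallyEq (heq.mono fun s h => h.1))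
  have hk := inner_add_inner_eq_zero_of_hasDerivAt ((k.hasDerivAt _).scomp 0 hcoord.fst) hIm
    (heq.mono fun s h => h.2.1)
  have hk' := inner_add_inner_eq_zero_of_hasDerivAt ((k.hasDerivAt_tangent _).scomp 0 hcoord.fst)
    hIm (heq.mono fun s h => h.2.2)
  have h0 := heq.self_of_nhds.2.2
  simp only [Function.comp_apply, hbase, real_inner_smul_left] at hk hk' h0
  refine ⟨a, b, ?_, by simpa [h0] using hk, by linarith⟩
  rw [← hy, coneFrame_apply, hv, Submodule.coe_zero, add_zero, smul_smul, add_comm]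

theorem stdForm_eq_zero_of_eventually_mem_conormalCone {w w' : ℝ → C4} {W W' : C4}
    (hw : HasDerivAt w W 0) (hw' : HasDerivAt w' W' 0) (h0 : w 0 = w' 0)
    (hcone : ∀ᶠ s in 𝓝 0, w s ∈ k.conormalCone)
    (hcone' : ∀ᶠ s in 𝓝 0, w' s ∈ k.conormalCone) : stdForm ![W, W'] = 0 := by
  obtain ⟨t, r, hr, hre, -⟩ := hcone.self_of_nhds
  obtain ⟨a, b, hW, hk, hk'⟩ := velocity_eq_of_eventually_mem_conormalCone hw hcone hr hre
  obtain ⟨a', b', hW', hl, hl'⟩ :=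
    velocity_eq_of_eventually_mem_conormalCone hw' hcone' hr (h0 ▸ hre)
  rw [stdForm_apply, hW, hW']
  simp only [inner_add_left, real_inner_smul_left, hk, hk', hl, hl', h0]
  ring

open ResolvedConifold in
theorem perturbedForm_eq_zero_of_mem_tangentVectors {ξ : R4 → R4} (hε : 0 < ε)
    (hξ : Differentiable ℝ ξ) (hξk : ∀ t r, ε ≤ r → ξ (r • k.toFun t) = k.tangent t)
    {q : ResolvedConifold} {X Y : TangentSpace 𝓘(ℝ, ℂ × ℂ × ℂ) q}
    (hX : X ∈ tangentVectors (ℂ × ℂ × ℂ) (conifoldTransition (perturbedConormal k ε)) q)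
    (hY : Y ∈ tangentVectors (ℂ × ℂ × ℂ) (conifoldTransition (perturbedConormal k ε)) q) :
    perturbedForm ξ ε q ![X, Y] = 0 := by
  have himage : ((shear ξ ε).symm ∘ proj₂) '' conifoldTransition (perturbedConormal k ε) ⊆
      k.conormalCone := by
    rw [conifoldTransition_perturbedConormal hε]
    rintro _ ⟨q, hq, rfl⟩
    obtain ⟨t, ht⟩ := mem_iUnion.1 hq
    exact shear_symm_mem_conormalCone hε hξk ht
  have hshear := (hasFDerivAt_shear_symm hξ ε q.proj₂).differentiableAt
  have hproj : MDifferentiableAt 𝓘(ℝ, ℂ × ℂ × ℂ) 𝓘(ℝ, C4) proj₂ q :=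
    (contMDiff_proj₂ q).mdifferentiableAt (by simp)
  have hmfderiv (X : TangentSpace 𝓘(ℝ, ℂ × ℂ × ℂ) q) :
      mfderiv 𝓘(ℝ, ℂ × ℂ × ℂ) 𝓘(ℝ, C4) ((shear ξ ε).symm ∘ proj₂) q X =
        fderiv ℝ (shear ξ ε).symm q.proj₂ (dproj₂ q X) := by
    rw [mfderiv_comp q hshear.mdifferentiableAt hproj, mfderiv_eq_fderiv]
    rfl
  have hf := hshear.mdifferentiableAt.comp q hproj
  obtain ⟨w, hw₀, hw, hwc⟩ := exists_hasDerivAt_of_mem_tangentVectors hX hf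
  obtain ⟨w', hw₀', hw', hwc'⟩ := exists_hasDerivAt_of_mem_tangentVectors hY hf
  rw [hmfderiv] at hw hw'
  rw [perturbedForm, lift_apply, pushforward, compContinuousLinearMap_pair]
  exact stdForm_eq_zero_of_eventually_mem_conormalCone hw hw' (hw₀.trans hw₀'.symm)
    (hwc.mono fun s hs => himage hs) (hwc'.mono fun s hs => himage hs)

open ResolvedConifold in
theorem exists_isOpen_perturbedForm_uniformlyTameOn {ξ : R4 → R4} (hε : 0 < ε)
    (hξ : ContDiff ℝ 1 ξ) (hcurl : ∀ t r, ε ≤ r → ‖curl ξ (r • k.toFun t)‖ ≤ r⁻¹) :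
    ∃ U, IsOpen U ∧ conifoldTransition (perturbedConormal k ε) ⊆ U ∧
      (perturbedForm ξ ε).UniformlyTameOn J metric U := by
  have hcont : Continuous fun q : ResolvedConifold => curl ξ (rePart q.proj₂) :=
    (continuous_curl hξ).comp (continuous_rePart.comp continuous_proj₂)
  refine ⟨{q | ε * ‖curl ξ (rePart q.proj₂)‖ < 3 / 2} ∩ {q | ε / 2 < ‖q.proj₂‖},
    (isOpen_lt (by fun_prop) continuous_const).inter
      (isOpen_lt continuous_const continuous_proj₂.norm), fun q hq => ?_,
    perturbedForm_uniformlyTameOn (hξ.differentiable one_ne_zero) (half_pos hε)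
      (fun q hq => hq.2.le) fun q hq => by rw [abs_of_pos hε]; exact hq.1.le⟩
  rw [conifoldTransition_perturbedConormal hε] at hq
  obtain ⟨t, ht⟩ := mem_iUnion.1 hq
  have hle := le_norm_imPart_of_mem_contractedFiber ht
  refine ⟨?_, (half_lt_self hε).trans_le (hle.trans (norm_imPart_le _))⟩
  calc ε * ‖curl ξ (rePart q.proj₂)‖ ≤ ε * ‖imPart q.proj₂‖⁻¹ :=
        mul_le_mul_of_nonneg_left (ht.1 ▸ hcurl t _ hle) hε.le
    _ ≤ 1 := by rw [← div_eq_mul_inv]; exact div_le_one_of_le₀ hle (norm_nonneg _)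
    _ < 3 / 2 := by norm_num

end Knot

end Conifold

end

open Conifold ResolvedConifold in
theorem theorem2_general (k : Knot) {ε : ℝ} (hε : 0 < ε) :
    ∃ ξ : R4 → R4, ContDiff ℝ ∞ ξ ∧ (∃ B : ℝ, ∀ x, ‖fderiv ℝ ξ x‖ ≤ B) ∧
      (∀ t r : ℝ, ε ≤ r → ξ (r • k.toFun t) = deriv k.toFun t) ∧
      IsTameLagrangian J metric (perturbedForm ξ ε)
        (conifoldTransition (perturbedConormal k ε)) ∧
      (perturbedForm ξ ε).ExactOn zeroSectionᶜ := by
  obtain ⟨ξ, hξ, hbound, hξk, hcurl⟩ := k.exists_vectorField hε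
  obtain ⟨U, hU, hsub, htame⟩ := Knot.exists_isOpen_perturbedForm_uniformlyTameOn hε
    (hξ.of_le (by simp)) hcurl
  refine ⟨ξ, hξ, hbound, hξk, ⟨⟨3, ?_, Knot.isEmbeddedSubmanifold_conifoldTransition hε⟩,
    ⟨U, hU, hsub, perturbedForm_symplecticOn hξ htame, htame⟩, fun q _ X hX Y hY =>
      Knot.perturbedForm_eq_zero_of_mem_tangentVectors hε (hξ.differentiable (by simp)) hξk hX hY⟩,
    perturbedForm_exactOn hξ ε _⟩
  simp [Module.finrank_prod, Complex.finrank_real_complex]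

theorem theorem2 (k : Conifold.Knot) (ε : ℝ) (hε : 0 < ε) (hε1 : ε < 1) :
    ∃ ξ : Conifold.R4 → Conifold.R4,
      ContDiff ℝ ∞ ξ ∧
      (∃ B : ℝ, ∀ x, ‖fderiv ℝ ξ x‖ ≤ B) ∧
      (∀ t : ℝ, ∀ r : ℝ, ε ≤ r → ξ (r • k.toFun t) = deriv k.toFun t) ∧
      Conifold.IsTameLagrangian Conifold.ResolvedConifold.J Conifold.ResolvedConifold.metric
        (Conifold.perturbedForm ξ ε)
        (Conifold.conifoldTransition (Conifold.perturbedConormal k ε)) ∧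
      (Conifold.perturbedForm ξ ε).ExactOn Conifold.ResolvedConifold.zeroSectionᶜ :=
  theorem2_general k hε
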